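/- Let $k$ be an algebraically closed field, $N\ge 2$, $S=k[x_0,\dots,x_N]$ and $\mathbb P^N=\operatorname{Proj} S$. For $f:\mathbb Z\to\mathbb Z$ put $\partial f(n)=f(n)-f(n-1)$. For a closed subscheme $X\subseteq\mathbb P^N$ of pure dimension $M$ with ideal sheaf $\mathcal I_X$, the postulation character of $X$ is $$\gamma_X(n)=\partial^{M+2}\bigl(h^0(\mathcal I_X(n))-h^0(\mathcal O_{\mathbb P^N}(n))\bigr),\qquad n\in\mathbb Z .$$ Let $Y\subseteq\mathbb P^N$ be an arithmetically Cohen–Macaulay closed subscheme of dimension $M+1$ (that is, $S/I_Y$ is a Cohen–Macaulay ring, where $I_Y$ is the saturated homogeneous ideal of $Y$) satisfying $G_1$ (every local ring of $Y$ of dimension at most $1$ is Gorenstein). Let $X,X'\subseteq Y$ be closed subschemes of pure dimension $M$ without embedded components. For $h\in\mathbb Z$, $X'$ is said to be obtained from $X$ by an elementary Gorenstein biliaison of height $h$ on $Y$ if there is an isomorphism of $\mathcal O_Y$-modules $\mathcal I_{X/Y}\cong\mathcal I_{X'/Y}(h)$ between the relative ideal sheaves. Proposition 1.12. If $X'$ is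 obtained from $X$ by an elementary Gorenstein biliaison of height $1$ on $Y$, then for all $n\in\mathbb Z$ $$\gamma_{X'}(n)=\gamma_X(n-1)+\gamma_Y(n).$$ -/

import Mathlib

open AlgebraicGeometry CategoryTheory

universe u

noncomputable section

namespace Postulation

/-! ### Projective space -/

/-- The polynomial ring `S = k[x_0, …, x_N]`. -/
abbrev CoordRing (k : Type u) [Field k] (N : ℕ) : Type u := MvPolynomial (Fin (N + 1)) k

/-- The standard grading of `S` by degree. -/
abbrev grading (k : Type u) [Field k] (N : ℕ) : ℕ → Submodule k (CoordRing k N) :=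
  MvPolynomial.homogeneousSubmodule (Fin (N + 1)) k

instance gradingIsGraded (k : Type u) [Field k] (N : ℕ) : GradedAlgebra (grading k N) :=
  MvPolynomial.gradedAlgebra

/-- Projective space `ℙ^N` over `k`. -/
abbrev ProjSpace (k : Type u) [Field k] (N : ℕ) : Scheme.{u} := Proj (grading k N)

variable {k : Type u} [Field k] {N : ℕ}

/-- The structure morphism `ℙ^N ⟶ Spec k`. -/
def structureMorphism (k : Type u) [Field k] (N : ℕ) :
    ProjSpace k N ⟶ Spec (CommRingCat.of k) :=
  Proj.toSpecZero (grading k N) ≫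
    Spec.map (CommRingCat.ofHom (algebraMap k (grading k N 0)))

/-- The ring homomorphism `k → Γ(ℙ^N, 𝒪)` given by the structure morphism. -/
def scalars (k : Type u) [Field k] (N : ℕ) : k →+* Γ(ProjSpace k N, ⊤) :=
  ((Scheme.ΓSpecIso (CommRingCat.of k)).inv ≫ (structureMorphism k N).appTop).hom

/-- The standard affine open `D₊(x_i)` of `ℙ^N`. -/
abbrev stdOpen (k : Type u) [Field k] {N : ℕ} (i : Fin (N + 1)) : (ProjSpace k N).Opens :=
  Proj.basicOpen (grading k N) (MvPolynomial.X i)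

theorem X_mem_grading (i : Fin (N + 1)) :
    (MvPolynomial.X i : CoordRing k N) ∈ grading k N 1 :=
  MvPolynomial.isHomogeneous_X k i

/-- For a form `F` of degree `n`, the function `F / x_i ^ n` on `D₊(x_i)`. -/
def formQuot (i : Fin (N + 1)) (n : ℕ) (F : CoordRing k N) (hF : F ∈ grading k N n) :
    Γ(ProjSpace k N, stdOpen k i) :=
  (Proj.awayToSection (grading k N) (MvPolynomial.X i)).hom
    (HomogeneousLocalization.Away.mk (grading k N) (X_mem_grading i) n F
      (by simpa only [smul_eq_mul, mul_one] using hF))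

/-- The function `x_j / x_i` on `D₊(x_i)`. -/
def coordQuot (i j : Fin (N + 1)) : Γ(ProjSpace k N, stdOpen k i) :=
  formQuot i 1 (MvPolynomial.X j) (X_mem_grading j)

/-! ### Ideal sheaves and Serre twists -/

section Twist

variable {X X' Z : Scheme.{u}}

/-- Restriction of functions from an open `U` to a smaller open `V`. -/
def res {U V : Z.Opens} (h : V ≤ U) : Γ(Z, U) →+* Γ(Z, V) :=
  (Z.presheaf.map (homOfLE h).op).hom

/-- `Γ(Z, U ⊓ V)` as an algebra over `Γ(Z, U)` through restriction. -/
instance restrictionAlgebra (U V : Z.Opens) : Algebra Γ(Z, U) Γ(Z, U ⊓ V) :=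
  (res (inf_le_left : U ⊓ V ≤ U)).toAlgebra

/-- The sections over `U` of the ideal sheaf `𝓘_{X/Z} = ker (𝒪_Z → j_* 𝒪_X)` of `j : X ⟶ Z`. -/
def idealSheaf (j : X ⟶ Z) (U : Z.Opens) : Ideal Γ(Z, U) := RingHom.ker (j.app U).hom

/-- The inverse image in `Z` of `D₊(x_i)`. -/
abbrev chart (f : Z ⟶ ProjSpace k N) (i : Fin (N + 1)) : Z.Opens := f ⁻¹ᵁ stdOpen k i

/-- The function `x_j / x_i` on the open `chart f i` of `Z`. -/
def chartQuot (f : Z ⟶ ProjSpace k N) (i j : Fin (N + 1)) : Γ(Z, chart f i) :=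
  (f.app (stdOpen k i)).hom (coordQuot i j)

/-- The transition function `(x_j / x_i) ^ n` of `f^* 𝒪(n)` on any open `W` contained in both
charts `chart f i` and `chart f j`. Since `x_i / x_j` is the inverse of `x_j / x_i` there, it is
`(x_j / x_i) ^ n` for `n ≥ 0` and `(x_i / x_j) ^ (-n)` for `n ≤ 0`. -/
def transition (f : Z ⟶ ProjSpace k N) (n : ℤ) (i j : Fin (N + 1)) (W : Z.Opens)
    (hi : W ≤ chart f i) (hj : W ≤ chart f j) : Γ(Z, W) :=
  res hi (chartQuot f i j) ^ n.toNat * res hj (chartQuot f j i) ^ (-n).toNat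

/-- The sections over `U` of the twist `𝓘(n) = 𝓘 ⊗ f^* 𝒪(n)` of an ideal sheaf `𝓘` of `𝒪_Z`.
The line bundle `𝒪(n)` is trivialised on `D₊(x_i)` by `x_i ^ n`, so that a section `s` of `𝓘(n)`
over `U` is a family of sections `s_i` of `𝓘` over `U ∩ D₊(x_i)` (with `s = s_i x_i ^ n`) such
that `s_i = (x_j / x_i) ^ n s_j` on the overlaps. -/
def twist (f : Z ⟶ ProjSpace k N) (𝓘 : ∀ U : Z.Opens, Ideal Γ(Z, U)) (n : ℤ) (U : Z.Opens) :
    Submodule Γ(Z, U) (∀ i : Fin (N + 1), Γ(Z, U ⊓ chart f i)) where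
  carrier := {s | (∀ i, s i ∈ 𝓘 (U ⊓ chart f i)) ∧
    ∀ (i j : Fin (N + 1)) (W : Z.Opens) (hi : W ≤ U ⊓ chart f i) (hj : W ≤ U ⊓ chart f j),
      res hi (s i) =
        transition f n i j W (hi.trans inf_le_right) (hj.trans inf_le_right) * res hj (s j)}
  zero_mem' := ⟨fun i => Ideal.zero_mem _, fun i j W hi hj => by simp⟩
  add_mem' := fun {s t} hs ht => ⟨fun i => Ideal.add_mem _ (hs.1 i) (ht.1 i),
    fun i j W hi hj => by
      simp only [Pi.add_apply, map_add, mul_add, hs.2 i j W hi hj, ht.2 i j W hi hj]⟩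
  smul_mem' := fun c s hs => ⟨fun i => by
      rw [Pi.smul_apply, Algebra.smul_def]
      exact Ideal.mul_mem_left _ _ (hs.1 i),
    fun i j W hi hj => by
      have key : ∀ (V : Z.Opens) (h : W ≤ U ⊓ V),
          res h (algebraMap Γ(Z, U) Γ(Z, U ⊓ V) c) = res (h.trans inf_le_left) c := fun V h => by
        change ((Z.presheaf.map _) ≫ (Z.presheaf.map _)).hom c = _
        rw [← Functor.map_comp]
        rfl
      simp only [Pi.smul_apply, Algebra.smul_def, map_mul, key, hs.2 i j W hi hj]
      ring⟩

/-- An isomorphism of sheaves of `𝒪_Z`-modules `𝓘_{X/Z} ≅ 𝓘_{X'/Z}(h)`: a family of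
`𝒪_Z(U)`-linear isomorphisms compatible with restriction. The twist is taken with respect to
`f : Z ⟶ ℙ^N`. -/
structure TwistedIdealIso (f : Z ⟶ ProjSpace k N) (j : X ⟶ Z) (j' : X' ⟶ Z) (h : ℤ) where
  equiv : ∀ U : Z.Opens, idealSheaf j U ≃ₗ[Γ(Z, U)] twist f (idealSheaf j') h U
  natural : ∀ (U V : Z.Opens) (hVU : V ≤ U) (s : idealSheaf j U) (t : idealSheaf j V),
    (t : Γ(Z, V)) = res hVU (s : Γ(Z, U)) →
      ∀ i : Fin (N + 1), (equiv V t : ∀ i, Γ(Z, V ⊓ chart f i)) i =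
        res (inf_le_inf_right _ hVU) ((equiv U s : ∀ i, Γ(Z, U ⊓ chart f i)) i)

end Twist

/-! ### Postulation character -/

/-- `h⁰(𝓘(n))`, the dimension over `k` of the global sections of `𝓘(n)`, for an ideal sheaf `𝓘`
of `𝒪_{ℙ^N}`. -/
def hZero (𝓘 : ∀ U : (ProjSpace k N).Opens, Ideal Γ(ProjSpace k N, U)) (n : ℤ) : ℕ :=
  letI : Module k (twist (𝟙 (ProjSpace k N)) 𝓘 n ⊤) := Module.compHom _ (scalars k N)
  Module.finrank k (twist (𝟙 (ProjSpace k N)) 𝓘 n ⊤)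

/-- The first difference `∂φ(n) = φ(n) - φ(n - 1)`. -/
def diff (φ : ℤ → ℤ) (n : ℤ) : ℤ := φ n - φ (n - 1)

/-- The postulation character `γ_X = ∂^{M+2} (h⁰ 𝓘_X(n) - h⁰ 𝒪_ℙ(n))` of a closed subscheme
`ι : X ⟶ ℙ^N` of dimension `M`. -/
def postulationCharacter (M : ℕ) {X : Scheme.{u}} (ι : X ⟶ ProjSpace k N) : ℤ → ℤ :=
  diff^[M + 2] fun n => (hZero (idealSheaf ι) n : ℤ) - (hZero (k := k) (N := N) (fun _ => ⊤) n : ℤ)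

/-! ### Conditions on schemes and biliaison -/

/-- `X` has dimension `M`, and so does each of its irreducible components. -/
def HasPureDim (X : Scheme.{u}) (M : ℕ) : Prop :=
  topologicalKrullDim X = M ∧ ∀ C ∈ irreducibleComponents X, topologicalKrullDim C = M

/-- The (locally Noetherian) scheme `X` has no embedded component: each associated point of `X`
is the generic point of an irreducible component. -/
def NoEmbeddedComponent (X : Scheme.{u}) : Prop :=
  ∀ x : X, IsLocalRing.maximalIdeal (X.presheaf.stalk x) ∈
      associatedPrimes (X.presheaf.stalk x) (X.presheaf.stalk x) →
    closure {x} ∈ irreducibleComponents X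

/-- A Noetherian local ring is Gorenstein if it has finite injective dimension over itself. -/
def IsGorensteinLocal (R : Type u) [CommRing R] [IsLocalRing R] : Prop :=
  IsNoetherianRing R ∧ ∃ n : ℕ, HasInjectiveDimensionLE (ModuleCat.of R R) n

/-- `G₁`, Gorenstein in codimension one: the local rings of dimension at most one are
Gorenstein. -/
def SatisfiesGOne (Y : Scheme.{u}) : Prop :=
  ∀ y : Y, ringKrullDim (Y.presheaf.stalk y) ≤ 1 → IsGorensteinLocal (Y.presheaf.stalk y)

/-- A Noetherian local ring is Cohen-Macaulay if its maximal ideal contains a regular sequence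
whose length is the dimension of the ring. -/
def IsCMLocal (R : Type u) [CommRing R] [IsLocalRing R] : Prop :=
  IsNoetherianRing R ∧ ∃ rs : List R, (∀ r ∈ rs, r ∈ IsLocalRing.maximalIdeal R) ∧
    RingTheory.Sequence.IsRegular R rs ∧ (rs.length : WithBot ℕ∞) = ringKrullDim R

/-- A Noetherian ring is Cohen-Macaulay if its localisations at maximal ideals are. -/
def IsCMRing (R : Type u) [CommRing R] : Prop :=
  IsNoetherianRing R ∧
    ∀ (m : Ideal R) [m.IsMaximal], IsCMLocal (Localization.AtPrime m)

/-- The saturated homogeneous ideal `I_Y` of a closed subscheme `i : Y ⟶ ℙ^N`: it is generated by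
the forms `F` that vanish on `Y`, that is, such that `F / x_i ^ n` (where `n = deg F`) is a section
of `𝓘_Y` over `D₊(x_i)` for all `i`. -/
def saturatedIdeal {Y : Scheme.{u}} (i : Y ⟶ ProjSpace k N) : Ideal (CoordRing k N) :=
  Ideal.span {F | ∃ (n : ℕ) (hF : F ∈ grading k N n),
    ∀ l : Fin (N + 1), formQuot l n F hF ∈ idealSheaf i (stdOpen k l)}

/-- `Y` is arithmetically Cohen-Macaulay: `S / I_Y` is a Cohen-Macaulay ring. -/
def IsACM {Y : Scheme.{u}} (i : Y ⟶ ProjSpace k N) : Prop :=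
  IsCMRing (CoordRing k N ⧸ saturatedIdeal i)

/-- `X'` is obtained from `X` by an elementary Gorenstein biliaison of height `h` on `Y`. Here
`X` and `X'` are closed subschemes of `Y` of pure dimension `M` without embedded component, `Y` is
an ACM closed subscheme of `ℙ^N` of dimension `M + 1` satisfying `G₁`, and
`𝓘_{X/Y} ≅ 𝓘_{X'/Y}(h)`. -/
structure IsElementaryGorensteinBiliaison {X X' Y : Scheme.{u}} (i : Y ⟶ ProjSpace k N)
    (j : X ⟶ Y) (j' : X' ⟶ Y) (M : ℕ) (h : ℤ) : Prop where
  closed_Y : IsClosedImmersion i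
  closed_X : IsClosedImmersion j
  closed_X' : IsClosedImmersion j'
  acm : IsACM i
  dim_Y : topologicalKrullDim Y = ((M + 1 : ℕ) : WithBot ℕ∞)
  gOne : SatisfiesGOne Y
  pure_X : HasPureDim X M
  pure_X' : HasPureDim X' M
  noEmb_X : NoEmbeddedComponent X
  noEmb_X' : NoEmbeddedComponent X'
  linEquiv : Nonempty (TwistedIdealIso i j j' h)

end Postulation

end

/-! The hypotheses on `Y` enter through depth. `Y` has dimension at least one and `S / I_Y` is
Cohen–Macaulay, so `S / I_Y` has depth at least two at the irrelevant ideal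
(`hasDepthTwo_saturatedIdeal`). A Čech argument then shows that every section of `𝒪_Y(n)` is cut out
by a form of degree `n`, and is zero for `n < 0` (`exists_form_of_mem_twist`). Therefore `H⁰(𝓘_X(n))
→ H⁰(𝓘_{X/Y}(n))` is surjective with kernel `H⁰(𝓘_Y(n))`, and `h⁰(𝓘_X(n)) = h⁰(𝓘_{X/Y}(n)) +
h⁰(𝓘_Y(n))` (`hZero_comp`); the same holds for `X'`.

Twisting the given isomorphism yields `h⁰(𝓘_{X/Y}(n - 1)) = h⁰(𝓘_{X'/Y}(n))`
(`TwistedIdealIso.finrank_eq`). Eliminating the relative terms gives `h⁰(𝓘_{X'}(n)) = h⁰(𝓘_X(n - 1))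
+ ∂h⁰(𝓘_Y(n))`. The function `h⁰(𝒪(n))` satisfies the same relation trivially, so it may be
subtracted throughout, and applying `∂^{M+2}` finishes the proof. -/

noncomputable section

namespace Postulation

variable {k : Type u} [Field k] {N : ℕ}

/-! ### Depth two and division by forms in the polynomial ring -/

section GradedAlgebra

open MvPolynomial

theorem homogeneousComponent_mul (p q : CoordRing k N) (d : ℕ) :
    homogeneousComponent d (p * q) =
      ∑ x ∈ Finset.HasAntidiagonal.antidiagonal d,
        homogeneousComponent x.1 p * homogeneousComponent x.2 q := by
  have h : ∀ (r : CoordRing k N) (n : ℕ),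
      ((DirectSum.decompose (grading k N) r n : grading k N n) : CoordRing k N) =
        homogeneousComponent n r := fun r n => by
    exact decomposition.decompose'_apply r n
  simp only [← h]
  rw [DirectSum.decompose_mul, DirectSum.coe_mul_apply_eq_sum_antidiagonal]

/-- An ideal of the polynomial ring containing the homogeneous components of its elements. -/
def IsGradedIdeal (I : Ideal (CoordRing k N)) : Prop :=
  ∀ p ∈ I, ∀ d, homogeneousComponent d p ∈ I

/-- The degree `d` part of `w * p` is `w₀ p_d` plus multiples of components of `p` of lower degree,
so induction on `d` applies. For a graded ideal this removes denominators introduced by localising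
at the irrelevant ideal. -/
theorem IsGradedIdeal.mem_of_mul_mem {I : Ideal (CoordRing k N)} (hI : IsGradedIdeal I)
    {w p : CoordRing k N} (hw : constantCoeff w ≠ 0) (h : w * p ∈ I) : p ∈ I := by
  have key : ∀ d, homogeneousComponent d p ∈ I := by
    intro d
    induction d using Nat.strong_induction_on with
    | _ d ih =>
      have h1 := hI _ h d
      rw [homogeneousComponent_mul, ← Finset.sum_erase_add _ _
        (Finset.HasAntidiagonal.mem_antidiagonal.mpr (zero_add d) : ((0, d) : ℕ × ℕ) ∈ _)] at h1
      have h2 : ∑ x ∈ (Finset.HasAntidiagonal.antidiagonal d).erase (0, d),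
          homogeneousComponent x.1 w * homogeneousComponent x.2 p ∈ I := by
        refine Ideal.sum_mem _ fun x hx => Ideal.mul_mem_left _ _ (ih _ ?_)
        obtain ⟨hx1, hx2⟩ := Finset.mem_erase.mp hx
        rw [Finset.HasAntidiagonal.mem_antidiagonal] at hx2
        by_contra hlt
        exact hx1 (Prod.ext (by dsimp; omega) (by dsimp; omega))
      have h3 := (I.add_mem_iff_right h2).mp h1
      dsimp only at h3
      rw [homogeneousComponent_zero] at h3
      have h4 := I.mul_mem_left (C (constantCoeff w)⁻¹) h3
      rwa [← mul_assoc, ← C_mul, ← constantCoeff_eq, inv_mul_cancel₀ hw, C_1, one_mul] at h4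
  rw [← sum_homogeneousComponent p]
  exact Ideal.sum_mem _ fun d _ => key d

/-- There are elements `a`, `b` of the irrelevant ideal which form a regular sequence modulo `I`
after localisation at the irrelevant ideal. -/
def HasDepthTwo (I : Ideal (CoordRing k N)) : Prop :=
  ∃ a b : CoordRing k N, constantCoeff a = 0 ∧ constantCoeff b = 0 ∧
    (∀ p, a * p ∈ I → p ∈ I) ∧
    ∀ p, b * p ∈ I ⊔ Ideal.span {a} →
      ∃ w, constantCoeff w ≠ 0 ∧ w * p ∈ I ⊔ Ideal.span {a}

theorem mem_sup_span_singleton {R : Type*} [CommRing R] {I : Ideal R} {a p : R} :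
    p ∈ I ⊔ Ideal.span {a} ↔ ∃ q, p - a * q ∈ I := by
  rw [Submodule.mem_sup]
  constructor
  · rintro ⟨y, hy, z, hz, rfl⟩
    obtain ⟨q, rfl⟩ := Ideal.mem_span_singleton'.mp hz
    exact ⟨q, by convert hy using 1; ring⟩
  · rintro ⟨q, hq⟩
    exact ⟨_, hq, a * q, Ideal.mul_mem_right _ _ (Ideal.mem_span_singleton_self a), by ring⟩

/-- Powers of a regular sequence again form a regular sequence. Large powers are needed because they
lie in the ideal generated by the `X i ^ e`. -/
theorem HasDepthTwo.pow {I : Ideal (CoordRing k N)} (h : HasDepthTwo I) (t : ℕ) :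
    ∃ a b : CoordRing k N, constantCoeff a = 0 ∧ constantCoeff b = 0 ∧
    (∀ p, a ^ t * p ∈ I → p ∈ I) ∧
    ∀ p, b ^ t * p ∈ I ⊔ Ideal.span {a ^ t} →
      ∃ w, constantCoeff w ≠ 0 ∧ w * p ∈ I ⊔ Ideal.span {a ^ t} := by
  obtain ⟨a, b, ha, hb, hra, hrb⟩ := h
  have hrat : ∀ s p, a ^ s * p ∈ I → p ∈ I := by
    intro s
    induction s with
    | zero => intro p hp; simpa using hp
    | succ s ih => intro p hp; exact ih p (hra _ (by convert hp using 1; ring))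
  have hrb1 : ∀ s p, b * p ∈ I ⊔ Ideal.span {a ^ s} →
      ∃ w, constantCoeff w ≠ 0 ∧ w * p ∈ I ⊔ Ideal.span {a ^ s} := by
    intro s
    induction s with
    | zero =>
      intro p _
      exact ⟨1, by simp, mem_sup_span_singleton.mpr ⟨p, by simp⟩⟩
    | succ s ih =>
      intro p hp
      obtain ⟨q, hq⟩ := mem_sup_span_singleton.mp hp
      obtain ⟨w, hw, hwp⟩ := hrb p (mem_sup_span_singleton.mpr
        ⟨a ^ s * q, by convert hq using 1; ring⟩)
      obtain ⟨q', hq'⟩ := mem_sup_span_singleton.mp hwp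
      -- Modulo `I`, `b p = a^(s+1) q` and `w p = a q'`; cancelling one factor `a` leaves the same
      -- problem for `q'` with exponent `s`.
      have h1 : b * q' - a ^ s * (w * q) ∈ I := by
        refine hra _ ?_
        convert I.sub_mem (I.mul_mem_left w hq) (I.mul_mem_left b hq') using 1
        ring
      obtain ⟨w', hw', hwq⟩ := ih q' (mem_sup_span_singleton.mpr ⟨_, h1⟩)
      obtain ⟨q'', hq''⟩ := mem_sup_span_singleton.mp hwq
      refine ⟨w' * w, by simp [hw, hw'], mem_sup_span_singleton.mpr ⟨q'', ?_⟩⟩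
      convert I.add_mem (I.mul_mem_left w' hq') (I.mul_mem_left a hq'') using 1
      ring
  have hrbs : ∀ s p, b ^ s * p ∈ I ⊔ Ideal.span {a ^ t} →
      ∃ w, constantCoeff w ≠ 0 ∧ w * p ∈ I ⊔ Ideal.span {a ^ t} := by
    intro s
    induction s with
    | zero => intro p hp; exact ⟨1, by simp, by simpa using hp⟩
    | succ s ih =>
      intro p hp
      obtain ⟨w, hw, h1⟩ := ih (b * p) (by convert hp using 1; ring)
      obtain ⟨w', hw', h2⟩ := hrb1 t (w * p) (by convert h1 using 1; ring)
      exact ⟨w' * w, by simp [hw, hw'], by rwa [mul_assoc]⟩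
  exact ⟨a, b, ha, hb, hrat t, hrbs t⟩

theorem mem_span_X_iff (p : CoordRing k N) :
    p ∈ Ideal.span (Set.range (X : Fin (N + 1) → CoordRing k N)) ↔ constantCoeff p = 0 := by
  rw [← Set.image_univ, mem_ideal_span_X_image, constantCoeff_eq]
  constructor
  · intro h
    by_contra hne
    obtain ⟨i, -, hi⟩ := h 0 (mem_support_iff.mpr hne)
    exact hi rfl
  · intro h m hm
    obtain ⟨i, hi⟩ : ∃ i, m i ≠ 0 := by
      by_contra! hall
      exact mem_support_iff.mp hm (by rwa [show m = 0 from Finsupp.ext hall])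
    exact ⟨i, Set.mem_univ i, hi⟩

theorem exists_pow_mem_span_X_pow (e : ℕ) :
    ∃ t : ℕ, ∀ p : CoordRing k N, constantCoeff p = 0 →
      p ^ t ∈ Ideal.span (Set.range fun i : Fin (N + 1) => (X i : CoordRing k N) ^ e) := by
  have h1 : Ideal.span (Set.range (X : Fin (N + 1) → CoordRing k N)) ≤
      (Ideal.span (Set.range fun i : Fin (N + 1) => (X i : CoordRing k N) ^ e)).radical := by
    rw [Ideal.span_le]
    rintro _ ⟨i, rfl⟩
    exact ⟨e, Ideal.subset_span ⟨i, rfl⟩⟩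
  obtain ⟨t, ht⟩ := Ideal.exists_pow_le_of_le_radical_of_fg h1
    ((isNoetherianRing_iff_ideal_fg _).mp inferInstance _)
  exact ⟨t, fun p hp => ht (Ideal.pow_mem_pow ((mem_span_X_iff p).mpr hp) t)⟩

/-- The local fractions `F j / X j ^ e` agree modulo `I`. Writing `a^t = ∑ u_i X_i^e` and `b^t = ∑
v_i X_i^e`, the elements `α = ∑ u_i F_i` and `β = ∑ v_i F_i` represent `a^t` and `b^t` times the
common fraction, so `b^t α = a^t β` modulo `I`. Regularity of `b^t` modulo `a^t` makes `α` divisible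
by `a^t` up to `w`, and the quotient `g` is `w` times the fraction. -/
theorem HasDepthTwo.exists_quotient {I : Ideal (CoordRing k N)} (h : HasDepthTwo I) (e : ℕ)
    (F : Fin (N + 1) → CoordRing k N)
    (hF : ∀ i j, F i * X j ^ e - F j * X i ^ e ∈ I) :
    ∃ g w : CoordRing k N, constantCoeff w ≠ 0 ∧ ∀ j, X j ^ e * g - w * F j ∈ I := by
  obtain ⟨t, ht⟩ := exists_pow_mem_span_X_pow (k := k) (N := N) e
  obtain ⟨a, b, ha, hb, hra, hrb⟩ := h.pow t
  obtain ⟨u, hu⟩ := Ideal.mem_span_range_iff_exists_fun.mp (ht a ha)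
  obtain ⟨v, hv⟩ := Ideal.mem_span_range_iff_exists_fun.mp (ht b hb)
  have hmul : ∀ (c : Fin (N + 1) → CoordRing k N) (j),
      (∑ i, c i * F i) * X j ^ e - (∑ i, c i * X i ^ e) * F j ∈ I := by
    intro c j
    rw [Finset.sum_mul, Finset.sum_mul, ← Finset.sum_sub_distrib]
    refine Ideal.sum_mem _ fun i _ => ?_
    convert I.mul_mem_left (c i) (hF i j) using 1
    ring
  have hab : b ^ t * (∑ i, u i * F i) - a ^ t * (∑ i, v i * F i) ∈ I := by
    rw [← hv]
    have h1 : ∑ j, v j * ((∑ i, u i * F i) * X j ^ e - (∑ i, u i * X i ^ e) * F j) ∈ I :=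
      Ideal.sum_mem _ fun j _ => I.mul_mem_left _ (hmul u j)
    rw [hu] at h1
    convert h1 using 1
    rw [Finset.sum_mul, Finset.mul_sum, ← Finset.sum_sub_distrib]
    exact Finset.sum_congr rfl fun j _ => by ring
  obtain ⟨w, hw, hwα⟩ := hrb _ (mem_sup_span_singleton.mpr ⟨_, hab⟩)
  obtain ⟨g, hg⟩ := mem_sup_span_singleton.mp hwα
  refine ⟨g, w, hw, fun j => hra _ ?_⟩
  have h1 := hmul u j
  rw [hu] at h1
  convert I.sub_mem (I.mul_mem_left w h1) (I.mul_mem_left (X j ^ e) hg) using 1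
  ring

theorem homogeneousComponent_mul_of_isHomogeneous {q : CoordRing k N} {m : ℕ}
    (hq : q.IsHomogeneous m) (p : CoordRing k N) (d : ℕ) :
    homogeneousComponent d (p * q) = if m ≤ d then homogeneousComponent (d - m) p * q else 0 := by
  rw [homogeneousComponent_mul]
  have h0 : ∀ x : ℕ × ℕ, x.2 ≠ m →
      homogeneousComponent x.1 p * homogeneousComponent x.2 q = 0 := fun x hx => by
    rw [homogeneousComponent_of_mem ((mem_homogeneousSubmodule _ _).mpr hq), if_neg hx, mul_zero]
  split_ifs with hmd
  · rw [Finset.sum_eq_single (d - m, m)]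
    · rw [homogeneousComponent_of_mem ((mem_homogeneousSubmodule _ _).mpr hq), if_pos rfl]
    · intro x hx hne
      refine h0 x fun h => hne (Prod.ext ?_ h)
      rw [Finset.HasAntidiagonal.mem_antidiagonal] at hx
      dsimp; omega
    · intro hx
      exact absurd (Finset.HasAntidiagonal.mem_antidiagonal.mpr (by dsimp; omega)) hx
  · refine Finset.sum_eq_zero fun x hx => h0 x ?_
    rw [Finset.HasAntidiagonal.mem_antidiagonal] at hx
    omega

theorem HasDepthTwo.exists_form {I : Ideal (CoordRing k N)} (hI : IsGradedIdeal I)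
    (h : HasDepthTwo I) (e m : ℕ) (F : Fin (N + 1) → CoordRing k N)
    (hFm : ∀ i, (F i).IsHomogeneous m)
    (hF : ∀ i j, F i * X j ^ e - F j * X i ^ e ∈ I) :
    ∃ g : CoordRing k N, (m < e → g = 0) ∧ (e ≤ m → g.IsHomogeneous (m - e)) ∧
      ∀ j, F j - g * X j ^ e ∈ I := by
  obtain ⟨g, w, hw, hg⟩ := h.exists_quotient e F hF
  -- In degree `m` only the constant term of `w` multiplies `F j`, and it is invertible.
  have hcomp := fun j => hI _ (hg j) m
  have hX : ∀ j : Fin (N + 1), (X j ^ e : CoordRing k N).IsHomogeneous e :=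
    fun j => isHomogeneous_X_pow j e
  simp only [map_sub, mul_comm (X _ ^ e), homogeneousComponent_mul_of_isHomogeneous (hX _),
    homogeneousComponent_mul_of_isHomogeneous (hFm _), le_refl, if_true, tsub_self,
    homogeneousComponent_zero] at hcomp
  have hC : (C (constantCoeff w)⁻¹ : CoordRing k N) * C (coeff 0 w) = 1 := by
    rw [← C_mul, ← constantCoeff_eq, inv_mul_cancel₀ hw, C_1]
  refine ⟨C (constantCoeff w)⁻¹ * if e ≤ m then homogeneousComponent (m - e) g else 0,
    fun h => by rw [if_neg (by omega), mul_zero], fun h => ?_, fun j => ?_⟩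
  · rw [if_pos h]
    exact (homogeneousComponent_isHomogeneous _ _).C_mul _
  · have h1 := I.mul_mem_left (- C (constantCoeff w)⁻¹) (hcomp j)
    convert h1 using 1
    split_ifs <;> linear_combination (-F j) * hC

end GradedAlgebra

/-! ### Quotients of forms as functions on projective space -/

section Forms
open MvPolynomial HomogeneousLocalization

instance (x : ProjSpace k N) : x.asHomogeneousIdeal.toIdeal.IsPrime := x.isPrime

/-- The value of a function at a point `x` of projective space, in the localisation of the
polynomial ring at `x`. -/
def value {U : (ProjSpace k N).Opens} (x : ProjSpace k N) (hx : x ∈ U) :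
    Γ(ProjSpace k N, U) →+* Localization x.asHomogeneousIdeal.toIdeal.primeCompl where
  toFun s := HomogeneousLocalization.val (𝒜 := grading k N) (s.1 ⟨x, hx⟩)
  map_one' := HomogeneousLocalization.val_one ..
  map_zero' := HomogeneousLocalization.val_zero ..
  map_add' _ _ := HomogeneousLocalization.val_add ..
  map_mul' _ _ := HomogeneousLocalization.val_mul ..

theorem value_res {U V : (ProjSpace k N).Opens} (h : V ≤ U) (x : ProjSpace k N) (hx : x ∈ V)
    (s : Γ(ProjSpace k N, U)) : value x hx (res h s) = value x (h hx) s :=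
  rfl

theorem section_ext {U : (ProjSpace k N).Opens} (s t : Γ(ProjSpace k N, U))
    (h : ∀ (x : ProjSpace k N) (hx : x ∈ U), value x hx s = value x hx t) : s = t :=
  Subtype.ext (funext fun x => HomogeneousLocalization.val_injective _ (h x.1 x.2))

theorem isUnit_germ_iff {U : (ProjSpace k N).Opens} (x : ProjSpace k N) (hx : x ∈ U)
    (s : Γ(ProjSpace k N, U)) :
    IsUnit ((ProjSpace k N).presheaf.germ U x hx s) ↔ IsUnit (value x hx s) := by
  refine Iff.trans ?_ (isUnit_iff_isUnit_val (𝒜 := grading k N)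
    (𝔭 := x.asHomogeneousIdeal.toIdeal) (s.1 ⟨x, hx⟩)).symm
  refine (MulEquiv.isUnit_map (Proj.stalkIso' (grading k N) x)).symm.trans (iff_of_eq ?_)
  exact congrArg _ (Proj.stalkIso'_germ (grading k N) U x hx s)

theorem value_formQuot (i : Fin (N + 1)) (n : ℕ) (F : CoordRing k N) (hF : F ∈ grading k N n)
    (x : ProjSpace k N) (hx : x ∈ stdOpen k i) :
    value x hx (formQuot i n F hF) =
      Localization.mk F (⟨X i ^ n, fun h => hx (Ideal.IsPrime.mem_of_pow_mem inferInstance n h)⟩ :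
        x.asHomogeneousIdeal.toIdeal.primeCompl) := by
  refine (ProjectiveSpectrum.Proj.awayToSection_apply (grading k N) (X i)
    (Away.mk (grading k N) (X_mem_grading i) n F (by simpa using hF)) ⟨x, hx⟩).trans ?_
  rw [Away.val_mk, Localization.mk_eq_mk', IsLocalization.map_mk', ← Localization.mk_eq_mk']
  rfl

theorem res_formQuot (i j : Fin (N + 1)) (n : ℕ) (F : CoordRing k N) (hF : F ∈ grading k N n)
    (W : (ProjSpace k N).Opens) (hi : W ≤ stdOpen k i) (hj : W ≤ stdOpen k j) :
    res hi (formQuot i n F hF) = res hi (coordQuot i j) ^ n * res hj (formQuot j n F hF) := by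
  refine section_ext _ _ fun x hx => ?_
  rw [map_mul, map_pow, value_res, value_res, value_res, coordQuot, value_formQuot, value_formQuot,
    value_formQuot, Localization.mk_pow, Localization.mk_mul, Localization.mk_eq_mk_iff,
    Localization.r_iff_exists]
  refine ⟨1, ?_⟩
  simp only [Submonoid.coe_mul, SubmonoidClass.coe_pow, OneMemClass.coe_one]
  ring

theorem formQuot_add (i : Fin (N + 1)) (n : ℕ) (F G : CoordRing k N) (hF : F ∈ grading k N n)
    (hG : G ∈ grading k N n) :
    formQuot i n (F + G) (add_mem hF hG) = formQuot i n F hF + formQuot i n G hG := by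
  rw [formQuot, formQuot, formQuot, ← map_add]
  congr 1
  refine HomogeneousLocalization.val_injective _ ?_
  rw [val_add, Away.val_mk, Away.val_mk, Away.val_mk, Localization.add_mk_self]

theorem formQuot_mul (i : Fin (N + 1)) (m n : ℕ) (F G : CoordRing k N) (hF : F ∈ grading k N m)
    (hG : G ∈ grading k N n) (hFG : F * G ∈ grading k N (m + n)) :
    formQuot i (m + n) (F * G) hFG = formQuot i m F hF * formQuot i n G hG := by
  rw [formQuot, formQuot, formQuot, ← map_mul]
  congr 1
  refine HomogeneousLocalization.val_injective _ ?_
  rw [val_mul, Away.val_mk, Away.val_mk, Away.val_mk, Localization.mk_mul]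
  congr 1
  exact Subtype.ext (pow_add _ _ _)

theorem formQuot_one (i : Fin (N + 1)) (h : (1 : CoordRing k N) ∈ grading k N 0) :
    formQuot i 0 1 h = 1 := by
  rw [formQuot, ← map_one (Proj.awayToSection (grading k N) (MvPolynomial.X i)).hom]
  congr 1

theorem coordQuot_self (i : Fin (N + 1)) : (coordQuot i i : Γ(ProjSpace k N, stdOpen k i)) = 1 := by
  rw [coordQuot, formQuot, ← map_one (Proj.awayToSection (grading k N) (MvPolynomial.X i)).hom]
  congr 1
  refine HomogeneousLocalization.val_injective _ ?_
  rw [val_one, Away.val_mk]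
  convert Localization.mk_self (⟨X i ^ 1, 1, rfl⟩ : Submonoid.powers (X i : CoordRing k N)) using 1
  congr 1
  exact (pow_one _).symm

theorem awayToSection_bijective (i : Fin (N + 1)) :
    Function.Bijective (Proj.awayToSection (grading k N) (X i : CoordRing k N)).hom := by
  have h := Proj.basicOpenIsoAway_hom (grading k N) (X i) (X_mem_grading i) one_pos
  rw [← h]
  exact ConcreteCategory.bijective_of_isIso
    (Proj.basicOpenIsoAway (grading k N) (X i) (X_mem_grading i) one_pos).hom

theorem formQuot_surjective (i : Fin (N + 1)) (s : Γ(ProjSpace k N, stdOpen k i)) :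
    ∃ (n : ℕ) (F : CoordRing k N) (hF : F ∈ grading k N n), formQuot i n F hF = s := by
  obtain ⟨z, rfl⟩ := (awayToSection_bijective i).2 s
  obtain ⟨n, F, hF, rfl⟩ := Away.mk_surjective (grading k N) (X_mem_grading i) z
  exact ⟨n, F, by simpa using hF, rfl⟩

theorem eq_zero_of_formQuot_eq_zero (i : Fin (N + 1)) (n : ℕ) (F : CoordRing k N)
    (hF : F ∈ grading k N n) (h : formQuot i n F hF = 0) : F = 0 := by
  have h1 := (awayToSection_bijective i).1 (h.trans (map_zero _).symm)
  have h2 := congrArg HomogeneousLocalization.val h1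
  rw [val_zero, Away.val_mk, ← Localization.mk_zero 1, Localization.mk_eq_mk_iff,
    Localization.r_iff_exists] at h2
  obtain ⟨⟨_, r, rfl⟩, hr⟩ := h2
  have hX : (X i : CoordRing k N) ≠ 0 := X_ne_zero i
  simpa [hX] using hr

theorem mem_basicOpen_formQuot (i : Fin (N + 1)) (n : ℕ) (F : CoordRing k N)
    (hF : F ∈ grading k N n) (x : ProjSpace k N) (hx : x ∈ stdOpen k i) :
    x ∈ (ProjSpace k N).basicOpen (formQuot i n F hF) ↔ F ∉ x.asHomogeneousIdeal := by
  rw [Scheme.mem_basicOpen _ _ x hx]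
  rw [isUnit_germ_iff, value_formQuot, Localization.mk_eq_mk',
    IsLocalization.AtPrime.isUnit_mk'_iff _ x.asHomogeneousIdeal.toIdeal]
  rfl

theorem ι_structureMorphism (i : Fin (N + 1)) :
    (stdOpen k i).ι ≫ structureMorphism k N = (stdOpen k i).toSpecΓ ≫
      Spec.map (CommRingCat.ofHom (algebraMap k (grading k N 0)) ≫
        CommRingCat.ofHom (fromZeroRingHom (grading k N) _) ≫
          Proj.awayToSection (grading k N) (X i : CoordRing k N)) := by
  have h : (stdOpen k i).ι = Proj.basicOpenToSpec (grading k N) (X i : CoordRing k N) ≫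
      Proj.awayι (grading k N) (X i) (X_mem_grading i) one_pos := by
    rw [Proj.awayι, ← Proj.basicOpenIsoSpec_hom _ _ (X_mem_grading i) one_pos,
      Iso.hom_inv_id_assoc]
  rw [structureMorphism, h, Category.assoc, Proj.awayι_toSpecZero_assoc, Proj.basicOpenToSpec,
    Category.assoc, ← Spec.map_comp, ← Spec.map_comp, Category.assoc]

/-- The action of `k` on sections is defined through the structure morphism; this makes it explicit
on charts, so that the maps from forms to sections are `k`-linear. -/
theorem res_scalars (i : Fin (N + 1)) (c : k) :
    res (le_top : stdOpen k i ≤ ⊤) (scalars k N c) = formQuot i 0 (C c) (isHomogeneous_C _ c) := by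
  have h : (Scheme.ΓSpecIso (CommRingCat.of k)).inv ≫ (structureMorphism k N).appTop ≫
      (stdOpen k i).ι.appTop ≫ (stdOpen k i).topIso.hom =
      CommRingCat.ofHom (algebraMap k (grading k N 0)) ≫
        CommRingCat.ofHom (fromZeroRingHom (grading k N) _) ≫
          Proj.awayToSection (grading k N) (X i : CoordRing k N) := by
    rw [← Scheme.Hom.comp_appTop_assoc, ι_structureMorphism]
    generalize CommRingCat.ofHom (algebraMap k (grading k N 0)) ≫
        CommRingCat.ofHom (fromZeroRingHom (grading k N) _) ≫
          Proj.awayToSection (grading k N) (X i : CoordRing k N) = φ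
    rw [Scheme.Hom.comp_appTop, Scheme.Opens.toSpecΓ_appTop, Category.assoc,
      ← Scheme.ΓSpecIso_inv_naturality_assoc, Category.assoc, Iso.inv_hom_id_assoc,
      Iso.inv_hom_id, Category.comp_id]
  have h2 : (stdOpen k i).ι.appTop ≫ (stdOpen k i).topIso.hom =
      (ProjSpace k N).presheaf.map (homOfLE (le_top : stdOpen k i ≤ ⊤)).op := by
    rw [Scheme.Opens.ι_appTop, Scheme.Opens.topIso_hom]
    exact ((ProjSpace k N).presheaf.map_comp _ _).symm
  rw [h2] at h
  refine Eq.trans (congrArg (fun f => f.hom c) h) ?_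
  refine congrArg (Proj.awayToSection (grading k N) (X i : CoordRing k N)).hom
    (HomogeneousLocalization.val_injective _ ?_)
  rw [Away.val_mk]
  change Localization.mk (C c : CoordRing k N) 1 = _
  congr 1

end Forms

/-! ### Forms on `Y` and the saturated ideal -/

section PullbackForms
open MvPolynomial

variable {Y : Scheme.{u}} (f : Y ⟶ ProjSpace k N)

theorem res_res {Z : Scheme.{u}} {U V W : Z.Opens} (h : V ≤ U) (h' : W ≤ V) (s : Γ(Z, U)) :
    res h' (res h s) = res (h'.trans h) s := by
  change ((Z.presheaf.map _) ≫ (Z.presheaf.map _)).hom s = _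
  rw [← Functor.map_comp]
  rfl

theorem res_self {Z : Scheme.{u}} {U : Z.Opens} (h : U ≤ U) (s : Γ(Z, U)) : res h s = s := by
  change (Z.presheaf.map (𝟙 _)).hom s = s
  rw [CategoryTheory.Functor.map_id]
  rfl

theorem app_res {Z T : Scheme.{u}} (g : Z ⟶ T) {U V : T.Opens} (h : V ≤ U) (s : Γ(T, U)) :
    (g.app V).hom (res h s) = res (g.preimage_mono h) ((g.app U).hom s) :=
  congrArg (fun q => q.hom s) (g.naturality (homOfLE h).op)

/-- For a polynomial `p` with component `p_n` of degree `n`, the function `p_n / x_l ^ n` on the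
inverse image of `D₊(x_l)`. -/
def formFun (l : Fin (N + 1)) (n : ℕ) : CoordRing k N →+ Γ(Y, chart f l) where
  toFun p := (f.app (stdOpen k l)).hom
    (formQuot l n (homogeneousComponent n p) (homogeneousComponent_mem n p))
  map_zero' := by
    simp only [map_zero]
    have h := formQuot_add l n (0 : CoordRing k N) 0 (zero_mem _) (zero_mem _)
    simp only [add_zero] at h
    rw [left_eq_add.mp h, map_zero]
  map_add' p q := by
    rw [← map_add, ← formQuot_add]
    congr 2
    exact map_add _ _ _

theorem formFun_of_mem (l : Fin (N + 1)) {n : ℕ} {F : CoordRing k N} (hF : F ∈ grading k N n) :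
    formFun f l n F = (f.app (stdOpen k l)).hom (formQuot l n F hF) := by
  have h : homogeneousComponent n F = F := by rw [homogeneousComponent_of_mem hF, if_pos rfl]
  simp only [formFun, AddMonoidHom.coe_mk, ZeroHom.coe_mk, h]

theorem formFun_homogeneousComponent (l : Fin (N + 1)) (n : ℕ) (p : CoordRing k N) :
    formFun f l n (homogeneousComponent n p) = formFun f l n p :=
  formFun_of_mem f l (homogeneousComponent_mem n p)

theorem formFun_eq_zero_of_ne (l : Fin (N + 1)) {m n : ℕ} (hmn : m ≠ n) {F : CoordRing k N}
    (hF : F.IsHomogeneous n) : formFun f l m F = 0 := by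
  rw [← formFun_homogeneousComponent, homogeneousComponent_of_mem hF, if_neg hmn, map_zero]

theorem formFun_mul (l : Fin (N + 1)) {m n : ℕ} {F G : CoordRing k N} (hF : F.IsHomogeneous m)
    (hG : G.IsHomogeneous n) :
    formFun f l (m + n) (F * G) = formFun f l m F * formFun f l n G := by
  rw [formFun_of_mem f l ((mem_homogeneousSubmodule _ _).mpr (hF.mul hG)),
    formFun_of_mem f l hF, formFun_of_mem f l hG,
    formQuot_mul l m n F G hF hG, map_mul]

theorem formFun_pow (l : Fin (N + 1)) {m : ℕ} {F : CoordRing k N} (hF : F.IsHomogeneous m)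
    (r : ℕ) : formFun f l (m * r) (F ^ r) = formFun f l m F ^ r := by
  induction r with
  | zero =>
    rw [pow_zero, pow_zero, mul_zero, formFun_of_mem f l
      ((mem_homogeneousSubmodule _ _).mpr (isHomogeneous_one _ _)), formQuot_one, map_one]
  | succ r ih => rw [pow_succ, pow_succ, mul_add, mul_one, formFun_mul f l (hF.pow r) hF, ih]

theorem formFun_X_self (l : Fin (N + 1)) : formFun f l 1 (X l) = 1 := by
  rw [formFun_of_mem f l (X_mem_grading l)]
  exact (congrArg _ (coordQuot_self l)).trans (map_one _)

theorem formFun_X (i j : Fin (N + 1)) : formFun f i 1 (X j) = chartQuot f i j :=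
  formFun_of_mem f i (X_mem_grading j)

theorem formFun_mul_X_pow_self (l : Fin (N + 1)) {m : ℕ} {F : CoordRing k N}
    (hF : F.IsHomogeneous m) (r : ℕ) :
    formFun f l (m + r) (F * X l ^ r) = formFun f l m F := by
  rw [formFun_mul f l hF (isHomogeneous_X_pow l r)]
  have h := formFun_pow f l (isHomogeneous_X k l) r
  rw [one_mul, formFun_X_self, one_pow] at h
  rw [h, mul_one]

theorem formFun_X_pow (i j : Fin (N + 1)) (r : ℕ) :
    formFun f i r (X j ^ r) = chartQuot f i j ^ r := by
  have h := formFun_pow f i (isHomogeneous_X k j) r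
  rwa [one_mul, formFun_X] at h

theorem formFun_mul_arbitrary (l : Fin (N + 1)) (d : ℕ) (p q : CoordRing k N) :
    formFun f l d (p * q) = ∑ x ∈ Finset.HasAntidiagonal.antidiagonal d,
      formFun f l x.1 p * formFun f l x.2 q := by
  have h : homogeneousComponent d (p * q) = homogeneousComponent d
      (∑ x ∈ Finset.HasAntidiagonal.antidiagonal d,
        homogeneousComponent x.1 p * homogeneousComponent x.2 q) := by
    rw [← homogeneousComponent_mul, homogeneousComponent_of_mem (homogeneousComponent_mem d _),
      if_pos rfl]
  rw [← formFun_homogeneousComponent, h, formFun_homogeneousComponent, map_sum]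
  refine Finset.sum_congr rfl fun x hx => ?_
  rw [Finset.HasAntidiagonal.mem_antidiagonal] at hx
  rw [← hx, formFun_mul f l (homogeneousComponent_isHomogeneous _ _)
    (homogeneousComponent_isHomogeneous _ _), formFun_homogeneousComponent,
    formFun_homogeneousComponent]

theorem res_formFun (i j : Fin (N + 1)) (n : ℕ) (p : CoordRing k N) (W : Y.Opens)
    (hi : W ≤ chart f i) (hj : W ≤ chart f j) :
    res hi (formFun f i n p) = res hi (chartQuot f i j) ^ n * res hj (formFun f j n p) := by
  have h := res_formQuot i j n (homogeneousComponent n p) (homogeneousComponent_mem n p)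
    (stdOpen k i ⊓ stdOpen k j) inf_le_left inf_le_right
  have h2 := congrArg (f.app (stdOpen k i ⊓ stdOpen k j)).hom h
  rw [map_mul, map_pow, app_res, app_res, app_res] at h2
  have h3 : res (inf_le_left : chart f i ⊓ chart f j ≤ _) (formFun f i n p) =
      res inf_le_left (chartQuot f i j) ^ n * res inf_le_right (formFun f j n p) := h2
  have h4 := congrArg (res (le_inf hi hj)) h3
  rwa [map_mul, map_pow, res_res, res_res, res_res] at h4

theorem res_chartQuot_mul (i j : Fin (N + 1)) (W : Y.Opens)
    (hi : W ≤ chart f i) (hj : W ≤ chart f j) :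
    res hi (chartQuot f i j) * res hj (chartQuot f j i) = 1 := by
  have h := res_formFun f i j 1 (X i) W hi hj
  rwa [formFun_X_self, map_one, pow_one, formFun_X, eq_comm] at h

theorem formFun_surjective [IsClosedImmersion f] (l : Fin (N + 1)) (s : Γ(Y, chart f l)) :
    ∃ (n : ℕ) (F : CoordRing k N), F.IsHomogeneous n ∧ formFun f l n F = s := by
  obtain ⟨t, rfl⟩ := f.app_surjective (stdOpen k l)
    (Proj.isAffineOpen_basicOpen (grading k N) (X l) (X_mem_grading l) one_pos) s
  obtain ⟨n, F, hF, rfl⟩ := formQuot_surjective l t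
  exact ⟨n, F, hF, formFun_of_mem f l hF⟩

theorem basicOpen_formFun (l : Fin (N + 1)) {n : ℕ} {F : CoordRing k N} (hF : F.IsHomogeneous n) :
    Y.basicOpen (formFun f l n F) = chart f l ⊓ f ⁻¹ᵁ Proj.basicOpen (grading k N) F := by
  rw [formFun_of_mem f l hF, ← Scheme.preimage_basicOpen]
  ext y
  constructor
  · intro hy
    have hy1 : f y ∈ stdOpen k l := (ProjSpace k N).basicOpen_le _ hy
    exact ⟨hy1, (mem_basicOpen_formQuot l n F hF _ hy1).mp hy⟩
  · rintro ⟨hy1, hy2⟩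
    exact (mem_basicOpen_formQuot l n F hF _ hy1).mpr hy2

/-- The polynomials all of whose components vanish on `Y`. -/
def vanishingIdeal : Ideal (CoordRing k N) where
  carrier := {p | ∀ d l, formFun f l d p = 0}
  zero_mem' d l := map_zero _
  add_mem' hp hq d l := by rw [map_add, hp d l, hq d l, add_zero]
  smul_mem' c p hp d l := by
    rw [smul_eq_mul, formFun_mul_arbitrary]
    exact Finset.sum_eq_zero fun x _ => by rw [hp x.2 l, mul_zero]

theorem saturatedIdeal_eq : saturatedIdeal f = vanishingIdeal f := by
  refine le_antisymm (Ideal.span_le.mpr ?_) fun p hp => ?_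
  · rintro F ⟨n, hF, h⟩ d l
    by_cases hd : d = n
    · subst hd
      rw [formFun_of_mem f l hF]
      exact h l
    · exact formFun_eq_zero_of_ne f l hd hF
  · rw [← sum_homogeneousComponent p]
    refine Ideal.sum_mem _ fun d _ => Ideal.subset_span
      ⟨d, homogeneousComponent_mem d p, fun l => ?_⟩
    exact hp d l

theorem mem_saturatedIdeal_iff {p : CoordRing k N} :
    p ∈ saturatedIdeal f ↔ ∀ d l, formFun f l d p = 0 := by
  rw [saturatedIdeal_eq]
  rfl

theorem mem_saturatedIdeal_iff_of_isHomogeneous {n : ℕ} {F : CoordRing k N}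
    (hF : F.IsHomogeneous n) : F ∈ saturatedIdeal f ↔ ∀ l, formFun f l n F = 0 := by
  rw [mem_saturatedIdeal_iff]
  refine ⟨fun h l => h n l, fun h d l => ?_⟩
  by_cases hd : d = n
  · rw [hd, h l]
  · exact formFun_eq_zero_of_ne f l hd hF

theorem isGradedIdeal_saturatedIdeal : IsGradedIdeal (saturatedIdeal f) := by
  intro p hp d
  rw [mem_saturatedIdeal_iff_of_isHomogeneous f (homogeneousComponent_isHomogeneous d p)]
  intro l
  rw [formFun_homogeneousComponent]
  exact (mem_saturatedIdeal_iff f).mp hp d l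

/-- On the affine chart of `x_l`, a function vanishing where `x_i x_j / x_l^2` is invertible is
killed by a power of it. There are finitely many charts, so one exponent serves all of them. -/
theorem exists_pow_mul_mem_saturatedIdeal [IsAffineHom f] (i j : Fin (N + 1)) {d : ℕ}
    {G : CoordRing k N} (hG : G.IsHomogeneous d)
    (h : ∀ (l : Fin (N + 1)) (W : Y.Opens) (hl : W ≤ chart f l) (_ : W ≤ chart f i)
      (_ : W ≤ chart f j), res hl (formFun f l d G) = 0) :
    ∃ r₀, ∀ r, r₀ ≤ r → (X i * X j) ^ r * G ∈ saturatedIdeal f := by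
  have hXX : (X i * X j : CoordRing k N).IsHomogeneous 2 :=
    (isHomogeneous_X k i).mul (isHomogeneous_X k j)
  have key : ∀ l, ∃ r, formFun f l 2 (X i * X j) ^ r * formFun f l d G = 0 := by
    intro l
    have haff : IsAffineOpen (chart f l) :=
      (Proj.isAffineOpen_basicOpen (grading k N) (X l) (X_mem_grading l) one_pos).preimage f
    have hb : Y.basicOpen (formFun f l 2 (X i * X j)) = chart f l ⊓ (chart f i ⊓ chart f j) := by
      rw [basicOpen_formFun f l hXX, Proj.basicOpen_mul]
      rfl
    refine exists_pow_mul_eq_zero_of_res_basicOpen_eq_zero_of_isAffineOpen Y haff _ _ ?_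
    exact h l _ (Y.basicOpen_le _) (hb.le.trans (inf_le_right.trans inf_le_left))
      (hb.le.trans (inf_le_right.trans inf_le_right))
  choose r hr using key
  refine ⟨∑ l, r l, fun s hs => ?_⟩
  rw [mem_saturatedIdeal_iff_of_isHomogeneous f ((hXX.pow s).mul hG)]
  intro l
  have hle : r l ≤ s := (Finset.single_le_sum (fun _ _ => Nat.zero_le _)
    (Finset.mem_univ l)).trans hs
  rw [formFun_mul f l (hXX.pow s) hG, formFun_pow f l hXX, ← Nat.sub_add_cancel hle, pow_add,
    mul_assoc, hr l, mul_zero]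

end PullbackForms

/-! ### Cocycle identities for the transition functions -/

section Transition

variable {Y : Scheme.{u}} (f : Y ⟶ ProjSpace k N)

/-- The function `x_j / x_i` as a unit on an open contained in both charts. -/
def chartUnit (i j : Fin (N + 1)) (W : Y.Opens) (hi : W ≤ chart f i) (hj : W ≤ chart f j) :
    Γ(Y, W)ˣ where
  val := res hi (chartQuot f i j)
  inv := res hj (chartQuot f j i)
  val_inv := res_chartQuot_mul f i j W hi hj
  inv_val := res_chartQuot_mul f j i W hj hi

theorem transition_eq (n : ℤ) (i j : Fin (N + 1)) (W : Y.Opens) (hi : W ≤ chart f i)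
    (hj : W ≤ chart f j) :
    transition f n i j W hi hj = ((chartUnit f i j W hi hj ^ n : Γ(Y, W)ˣ) : Γ(Y, W)) := by
  have h : chartUnit f i j W hi hj ^ n =
      chartUnit f i j W hi hj ^ n.toNat * (chartUnit f i j W hi hj)⁻¹ ^ (-n).toNat := by
    rw [← zpow_natCast, ← zpow_natCast, inv_zpow', ← zpow_add]
    congr 1
    omega
  rw [h, Units.val_mul, Units.val_pow_eq_pow_val, Units.val_pow_eq_pow_val]
  rfl

theorem transition_add (m n : ℤ) (i j : Fin (N + 1)) (W : Y.Opens) (hi : W ≤ chart f i)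
    (hj : W ≤ chart f j) :
    transition f (m + n) i j W hi hj = transition f m i j W hi hj * transition f n i j W hi hj := by
  rw [transition_eq, transition_eq, transition_eq, zpow_add, Units.val_mul]

theorem transition_self (n : ℤ) (i : Fin (N + 1)) (W : Y.Opens) (hi hi' : W ≤ chart f i) :
    transition f n i i W hi hi' = 1 := by
  have h : chartUnit f i i W hi hi' = 1 := Units.ext <| by
    change res hi (chartQuot f i i) = 1
    rw [← formFun_X, formFun_X_self, map_one]
  rw [transition_eq, h, one_zpow, Units.val_one]

theorem transition_trans (n : ℤ) (i j l : Fin (N + 1)) (W : Y.Opens) (hi : W ≤ chart f i)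
    (hj : W ≤ chart f j) (hl : W ≤ chart f l) :
    transition f n i j W hi hj * transition f n j l W hj hl = transition f n i l W hi hl := by
  have h : chartUnit f i j W hi hj * chartUnit f j l W hj hl = chartUnit f i l W hi hl :=
    Units.ext <| by
      change res hi (chartQuot f i j) * res hj (chartQuot f j l) = res hi (chartQuot f i l)
      rw [← formFun_X f i l, ← formFun_X f j l, res_formFun f i j 1 _ W hi hj, pow_one]
  rw [transition_eq, transition_eq, transition_eq, ← h, mul_zpow, Units.val_mul]

theorem res_transition (n : ℤ) (i j : Fin (N + 1)) {V W : Y.Opens} (h : W ≤ V)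
    (hi : V ≤ chart f i) (hj : V ≤ chart f j) :
    res h (transition f n i j V hi hj) = transition f n i j W (h.trans hi) (h.trans hj) := by
  rw [transition, transition, map_mul, map_pow, map_pow, res_res, res_res]

theorem transition_of_nonneg {n : ℤ} (hn : 0 ≤ n) (i j : Fin (N + 1)) (W : Y.Opens)
    (hi : W ≤ chart f i) (hj : W ≤ chart f j) :
    transition f n i j W hi hj = res hi (chartQuot f i j) ^ n.toNat := by
  rw [transition, Int.toNat_of_nonpos (by omega : -n ≤ 0), pow_zero, mul_one]

end Transition

/-! ### Sections of `𝒪_Y(n)` come from forms -/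

section GlobalSections
open MvPolynomial

variable {Y : Scheme.{u}} (f : Y ⟶ ProjSpace k N)

/-- Clearing denominators turns a section into forms that satisfy the overlap relations modulo the
saturated ideal; depth two then glues them into a single form. -/
theorem exists_form_of_mem_twist [IsClosedImmersion f] (h : HasDepthTwo (saturatedIdeal f))
    (n : ℤ) (s : ∀ i : Fin (N + 1), Γ(Y, ⊤ ⊓ chart f i))
    (hs : s ∈ twist f (fun _ => ⊤) n ⊤) :
    ∃ g : CoordRing k N, g.IsHomogeneous n.toNat ∧ (n < 0 → g = 0) ∧
      ∀ j, s j = res inf_le_right (formFun f j n.toNat g) := by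
  set p := n.toNat with hp
  set q := (-n).toNat with hq
  have hle : ∀ i, chart f i ≤ ⊤ ⊓ chart f i := fun i => le_inf le_top le_rfl
  choose d F hF hFs using fun i => formFun_surjective f i (res (hle i) (s i))
  set B := ∑ i, d i
  have hdB : ∀ i, d i ≤ B := fun i =>
    Finset.single_le_sum (f := d) (fun _ _ => Nat.zero_le _) (Finset.mem_univ i)
  obtain ⟨F1, hF1, hF1s⟩ : ∃ F1 : Fin (N + 1) → CoordRing k N,
      (∀ i, (F1 i).IsHomogeneous (B + p)) ∧
        ∀ i, formFun f i (B + p) (F1 i) = res (hle i) (s i) := by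
    refine ⟨fun i => F i * X i ^ (B + p - d i), fun i => ?_, fun i => ?_⟩
    · have h1 := (hF i).mul (isHomogeneous_X_pow (R := k) i (B + p - d i))
      have h2 := hdB i
      rwa [show d i + (B + p - d i) = B + p by omega] at h1
    · have h1 := formFun_mul_X_pow_self f i (hF i) (B + p - d i)
      have h2 := hdB i
      rwa [show d i + (B + p - d i) = B + p by omega, hFs] at h1
  have hX : ∀ (i : Fin (N + 1)) (r : ℕ), (X i ^ r : CoordRing k N).IsHomogeneous r :=
    fun i r => isHomogeneous_X_pow i r
  -- With `n = p - q` and `s_i = F1_i / x_i^(B+p)`, the rule `s_i = (x_j/x_i)^n s_j` reads `F1_i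
  -- x_j^(B+q) = F1_j x_i^(B+q)`. It holds on the overlap of the two charts, hence everywhere on `Y`
  -- after multiplication by a power of `x_i x_j`.
  have hG : ∀ i j, (F1 i * X j ^ (B + q) - F1 j * X i ^ (B + q)).IsHomogeneous
      (B + p + (B + q)) := fun i j => ((hF1 i).mul (hX j _)).sub ((hF1 j).mul (hX i _))
  have hvan : ∀ i j, ∃ r₀, ∀ r, r₀ ≤ r →
      (X i * X j) ^ r * (F1 i * X j ^ (B + q) - F1 j * X i ^ (B + q)) ∈ saturatedIdeal f := by
    intro i j
    refine exists_pow_mul_mem_saturatedIdeal f i j (hG i j) fun l W hl hi hj => ?_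
    have hs' := hs.2 i j W (le_inf le_top hi) (le_inf le_top hj)
    have h1 := res_formFun f l i (B + p) (F1 i) W hl hi
    have h2 := res_formFun f l j (B + p) (F1 j) W hl hj
    have h3 := res_formFun f l i 1 (X j) W hl hi
    have h4 := res_formFun f l j 1 (X i) W hl hj
    rw [hF1s, res_res] at h1 h2
    rw [formFun_X, formFun_X, pow_one] at h3 h4
    rw [map_sub, formFun_mul f l (hF1 i) (hX j _), formFun_mul f l (hF1 j) (hX i _), map_sub,
      map_mul, map_mul, h1, h2, formFun_X_pow, formFun_X_pow, map_pow, map_pow, hs', transition,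
      ← hp, ← hq]
    generalize res hl (chartQuot f l i) = a at *
    generalize res hl (chartQuot f l j) = b at *
    generalize res hi (chartQuot f i j) = c at *
    generalize res hj (chartQuot f j i) = c' at *
    have e1 : b ^ p = a ^ p * c ^ p := by rw [← mul_pow, ← h3]
    have e2 : a ^ q = b ^ q * c' ^ q := by rw [← mul_pow, ← h4]
    rw [pow_add a B q, pow_add b B p, e1, e2]
    ring
  choose r₀ hr₀ using hvan
  set r := ∑ i, ∑ j, r₀ i j
  have hr : ∀ i j, r₀ i j ≤ r := fun i j =>
    (Finset.single_le_sum (f := fun j => r₀ i j) (fun _ _ => Nat.zero_le _)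
      (Finset.mem_univ j)).trans (Finset.single_le_sum (f := fun i => ∑ j, r₀ i j)
        (fun _ _ => Nat.zero_le _) (Finset.mem_univ i))
  -- The factor `(x_i x_j)^r` is absorbed by raising numerators and denominators by `r`. The degree
  -- of the quotient is `(B+p+r) - (B+q+r) = n`.
  obtain ⟨g, hg0, hg1, hg⟩ := h.exists_form (isGradedIdeal_saturatedIdeal f) (B + q + r)
    (B + p + r) (fun i => F1 i * X i ^ r) (fun i => (hF1 i).mul (hX i r)) fun i j => by
      convert hr₀ i j r (hr i j) using 1
      ring
  have hres : ∀ j, s j = res inf_le_right (res (hle j) (s j)) := fun j => by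
    rw [res_res, res_self]
  have hgF : ∀ j, res (hle j) (s j) = formFun f j (B + p + r) (g * X j ^ (B + q + r)) :=
    fun j => by
      have h1 := (mem_saturatedIdeal_iff f).mp (hg j) (B + p + r) j
      rwa [map_sub, formFun_mul_X_pow_self f j (hF1 j), hF1s, sub_eq_zero] at h1
  rcases lt_or_ge n 0 with hn | hn
  · have hg' : g = 0 := hg0 (by omega)
    subst hg'
    refine ⟨0, isHomogeneous_zero _ _ _, fun _ => rfl, fun j => ?_⟩
    rw [hres, hgF, zero_mul, map_zero, map_zero, map_zero, map_zero]
  · have hq0 : q = 0 := by omega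
    have hg' := hg1 (by omega)
    rw [show B + p + r - (B + q + r) = p by omega] at hg'
    refine ⟨g, hg', fun h => absurd h (by omega), fun j => ?_⟩
    rw [hres, hgF, show B + p + r = p + (B + q + r) by omega, formFun_mul_X_pow_self f j hg']

end GlobalSections

/-! ### The twisted isomorphism in local trivialisations -/

section TwistIso

variable {X X' Y : Scheme.{u}} {f : Y ⟶ ProjSpace k N} {j : X ⟶ Y} {j' : X' ⟶ Y} {h : ℤ}

theorem res_mem_idealSheaf {Z T : Scheme.{u}} (g : Z ⟶ T) {U V : T.Opens} (hVU : V ≤ U)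
    {s : Γ(T, U)} (hs : s ∈ idealSheaf g U) : res hVU s ∈ idealSheaf g V := by
  change (g.app V).hom (res hVU s) = 0
  rw [app_res, show (g.app U).hom s = 0 from hs, map_zero]

/-- The component at the index `i` of an isomorphism `𝓘_{X/Y} ≅ 𝓘_{X'/Y}(h)`, over an open contained
in the chart `chart f i`. -/
def TwistedIdealIso.component (E : TwistedIdealIso f j j' h) (U : Y.Opens) (i : Fin (N + 1))
    (hU : U ≤ chart f i) : idealSheaf j U →ₗ[Γ(Y, U)] Γ(Y, U) where
  toFun s := res (le_inf le_rfl hU) ((E.equiv U s : ∀ i, Γ(Y, U ⊓ chart f i)) i)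
  map_add' s t := by
    rw [map_add, Submodule.coe_add, Pi.add_apply, map_add]
  map_smul' c s := by
    rw [map_smul, Submodule.coe_smul, Pi.smul_apply, Algebra.smul_def, map_mul]
    change res _ (res _ c) * _ = _
    rw [res_res, res_self]
    rfl

variable (E : TwistedIdealIso f j j' h)

theorem TwistedIdealIso.component_mem (U : Y.Opens) (i : Fin (N + 1)) (hU : U ≤ chart f i)
    (s : idealSheaf j U) : E.component U i hU s ∈ idealSheaf j' U :=
  res_mem_idealSheaf j' _ ((E.equiv U s).2.1 i)

theorem TwistedIdealIso.res_component {U V : Y.Opens} (hVU : V ≤ U) (i : Fin (N + 1))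
    (hU : U ≤ chart f i) (s : idealSheaf j U) :
    res hVU (E.component U i hU s) =
      E.component V i (hVU.trans hU) ⟨res hVU s, res_mem_idealSheaf j hVU s.2⟩ := by
  change res hVU (res _ _) = res _ _
  rw [E.natural U V hVU s ⟨res hVU s, res_mem_idealSheaf j hVU s.2⟩ rfl i, res_res, res_res]

theorem TwistedIdealIso.component_eq (U : Y.Opens) (i l : Fin (N + 1)) (hi : U ≤ chart f i)
    (hl : U ≤ chart f l) (s : idealSheaf j U) :
    E.component U i hi s = transition f h i l U hi hl * E.component U l hl s :=
  (E.equiv U s).2.2 i l U (le_inf le_rfl hi) (le_inf le_rfl hl)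

/-- Inside one chart a section of the twist is determined by its component there: the others are
transition functions times it. -/
theorem TwistedIdealIso.component_injective (U : Y.Opens) (i : Fin (N + 1)) (hU : U ≤ chart f i) :
    Function.Injective (E.component U i hU) := by
  rw [← LinearMap.ker_eq_bot, LinearMap.ker_eq_bot']
  intro s hs
  refine (E.equiv U).map_eq_zero_iff.mp (Subtype.ext (funext fun l => ?_))
  have h1 := (E.equiv U s).2.2 l i (U ⊓ chart f l) le_rfl
    (le_inf inf_le_left (inf_le_left.trans hU))
  rw [res_self] at h1
  rw [h1]
  have h2 := congrArg (res (inf_le_left : U ⊓ chart f l ≤ U)) hs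
  change res _ (res _ _) = _ at h2
  rw [res_res, map_zero] at h2
  rw [h2, mul_zero]
  rfl

/-- Transition functions spread `t` to all charts, and the cocycle identity makes the result a
section of the twist. -/
theorem TwistedIdealIso.exists_component_eq (U : Y.Opens) (i : Fin (N + 1)) (hU : U ≤ chart f i)
    (t : Γ(Y, U)) (ht : t ∈ idealSheaf j' U) : ∃ s, E.component U i hU s = t := by
  let v : ∀ l : Fin (N + 1), Γ(Y, U ⊓ chart f l) := fun l =>
    transition f h l i (U ⊓ chart f l) inf_le_right (inf_le_left.trans hU) * res inf_le_left t
  have hv : v ∈ twist f (idealSheaf j') h U := by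
    refine ⟨fun l => Ideal.mul_mem_left _ _ (res_mem_idealSheaf j' _ ht), fun l m W hl hm => ?_⟩
    simp only [v, map_mul, res_res, res_transition]
    rw [← mul_assoc, transition_trans]
  refine ⟨(E.equiv U).symm ⟨v, hv⟩, ?_⟩
  change res _ ((E.equiv U ((E.equiv U).symm ⟨v, hv⟩)).1 i) = t
  rw [LinearEquiv.apply_symm_apply]
  change res _ (v i) = t
  simp only [v]
  rw [transition_self, one_mul, res_res, res_self]

end TwistIso

/-! ### Dimensions of spaces of global sections -/

section Cohomology
open MvPolynomial

/-- Families of functions on the charts of `Y`. -/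
def Cochains {Y : Scheme.{u}} (f : Y ⟶ ProjSpace k N) : Type u :=
  ∀ i : Fin (N + 1), Γ(Y, ⊤ ⊓ chart f i)

variable {X X' Y : Scheme.{u}} (f : Y ⟶ ProjSpace k N) (j : X ⟶ Y) (j' : X' ⟶ Y)

instance : AddCommGroup (Cochains f) :=
  inferInstanceAs (AddCommGroup (∀ i : Fin (N + 1), Γ(Y, ⊤ ⊓ chart f i)))

instance cochainsModule : Module Γ(Y, ⊤) (Cochains f) :=
  inferInstanceAs (Module Γ(Y, ⊤) (∀ i : Fin (N + 1), Γ(Y, ⊤ ⊓ chart f i)))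

/-- The ring homomorphism `k → Γ(Y, 𝒪)`. -/
def pullbackScalars : k →+* Γ(Y, ⊤) := (f.app ⊤).hom.comp (scalars k N)

instance : Module k (Cochains f) := Module.compHom _ (pullbackScalars f)

theorem cochains_smul_apply (c : k) (s : Cochains f) (i : Fin (N + 1)) :
    (c • s) i = res le_top (pullbackScalars f c) * s i :=
  rfl

theorem formFun_smul (l : Fin (N + 1)) (n : ℕ) (c : k) (p : CoordRing k N) :
    formFun f l n (c • p) = res le_top (pullbackScalars f c) * formFun f l n p := by
  have h0 : formFun f l 0 (C c) = res le_top (pullbackScalars f c) := by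
    rw [formFun_of_mem f l ((mem_homogeneousSubmodule _ _).mpr (isHomogeneous_C _ c)),
      ← res_scalars, app_res]
    rfl
  have hC : (C c : CoordRing k N).IsHomogeneous 0 := isHomogeneous_C _ c
  have h1 := formFun_mul f l hC (homogeneousComponent_isHomogeneous n p)
  rw [zero_add, h0, formFun_homogeneousComponent] at h1
  rw [← formFun_homogeneousComponent, map_smul, smul_eq_C_mul, h1]

/-- The global sections of the twist of an ideal sheaf, as a vector space. -/
def twistSections (𝓘 : ∀ U : Y.Opens, Ideal Γ(Y, U)) (n : ℤ) : Submodule k (Cochains f) where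
  carrier := {s | s ∈ twist f 𝓘 n ⊤}
  zero_mem' := (twist f 𝓘 n ⊤).zero_mem
  add_mem' := (twist f 𝓘 n ⊤).add_mem
  smul_mem' c _ hs := (twist f 𝓘 n ⊤).smul_mem (pullbackScalars f c) hs

theorem hZero_eq_finrank (𝓘 : ∀ U : (ProjSpace k N).Opens, Ideal Γ(ProjSpace k N, U)) (n : ℤ) :
    hZero 𝓘 n = Module.finrank k (twistSections (𝟙 (ProjSpace k N)) 𝓘 n) := by
  unfold hZero
  let : Module k (twist (𝟙 (ProjSpace k N)) 𝓘 n ⊤) := Module.compHom _ (scalars k N)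
  refine LinearEquiv.finrank_eq
    { toFun := fun s => ⟨s.1, s.2⟩
      invFun := fun s => ⟨s.1, s.2⟩
      map_add' := fun _ _ => rfl
      map_smul' := fun _ _ => rfl
      left_inv := fun _ => rfl
      right_inv := fun _ => rfl }

/-- The family of the functions `p_n / x_i ^ n`. -/
def formCochain (n : ℕ) : CoordRing k N →ₗ[k] Cochains f where
  toFun p i := res inf_le_right (formFun f i n p)
  map_add' p q := _root_.funext fun i => by rw [map_add, map_add]; rfl
  map_smul' c p := _root_.funext fun i => by
    rw [formFun_smul, map_mul, res_res]
    rfl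

theorem formCochain_apply (n : ℕ) (p : CoordRing k N) (i : Fin (N + 1)) :
    formCochain f n p i = res inf_le_right (formFun f i n p) :=
  rfl

theorem formCochain_mem {n : ℤ} (hn : 0 ≤ n) (p : CoordRing k N) :
    formCochain f n.toNat p ∈ twistSections f (fun _ => ⊤) n := by
  refine ⟨fun _ => trivial, fun i l W hi hl => ?_⟩
  rw [transition_of_nonneg f hn]
  rw [formCochain_apply, formCochain_apply, res_res, res_res]
  exact res_formFun f i l _ p W _ _

theorem twistSections_le [IsClosedImmersion f] (h : HasDepthTwo (saturatedIdeal f))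
    (𝓘 : ∀ U : Y.Opens, Ideal Γ(Y, U)) (n : ℤ) :
    twistSections f 𝓘 n ≤ (homogeneousSubmodule (Fin (N + 1)) k n.toNat).map
      (formCochain f n.toNat) := by
  intro s hs
  obtain ⟨g, hg, -, hgs⟩ := exists_form_of_mem_twist f h n s ⟨fun _ => trivial, hs.2⟩
  exact ⟨g, hg, _root_.funext fun i => (hgs i).symm⟩

theorem finite_twistSections [IsClosedImmersion f] (h : HasDepthTwo (saturatedIdeal f))
    (𝓘 : ∀ U : Y.Opens, Ideal Γ(Y, U)) (n : ℤ) : Module.Finite k (twistSections f 𝓘 n) := by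
  have : Module.Finite k ((homogeneousSubmodule (Fin (N + 1)) k n.toNat).map
      (formCochain f n.toNat)) :=
    Module.Finite.iff_fg.mpr ((homogeneousSubmodule_fg _ k n.toNat).map _)
  exact Submodule.finiteDimensional_of_le (twistSections_le f h 𝓘 n)

/-- Pullback of families of functions from projective space to `Y`. -/
def pullbackCochains : Cochains (𝟙 (ProjSpace k N)) →ₗ[k] Cochains f where
  toFun s i := (f.app (⊤ ⊓ chart (𝟙 (ProjSpace k N)) i)).hom (s i)
  map_add' s t := _root_.funext fun i => map_add _ _ _
  map_smul' c s := _root_.funext fun i => by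
    rw [cochains_smul_apply, map_mul, app_res]
    rfl

theorem pullbackCochains_formCochain (n : ℕ) (p : CoordRing k N) :
    pullbackCochains f (formCochain (𝟙 (ProjSpace k N)) n p) = formCochain f n p :=
  _root_.funext fun i => app_res f (inf_le_right : ⊤ ⊓ chart (𝟙 (ProjSpace k N)) i ≤ _)
    (formFun (𝟙 (ProjSpace k N)) i n p)

theorem pullbackCochains_mem {n : ℤ} {s : Cochains (𝟙 (ProjSpace k N))}
    (hs : s ∈ twistSections (𝟙 (ProjSpace k N)) (idealSheaf (j ≫ f)) n) :
    pullbackCochains f s ∈ twistSections f (idealSheaf j) n := by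
  refine ⟨fun i => hs.1 i, fun i l W hi hl => ?_⟩
  let V : (ProjSpace k N).Opens :=
    (⊤ ⊓ chart (𝟙 (ProjSpace k N)) i) ⊓ (⊤ ⊓ chart (𝟙 (ProjSpace k N)) l)
  have h1 := congrArg (f.app V).hom (hs.2 i l V inf_le_left inf_le_right)
  rw [map_mul, transition, map_mul, map_pow, map_pow, app_res, app_res, app_res, app_res] at h1
  have hW : W ≤ f ⁻¹ᵁ V := le_inf hi hl
  have h2 := congrArg (res hW) h1
  rw [map_mul, map_mul, map_pow, map_pow, res_res, res_res, res_res, res_res] at h2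
  exact h2

/-- This is the surjectivity that replaces `H¹(𝓘_Y(n)) = 0`. A section on `Y` is given by a form,
and the same form on projective space lies in the ideal sheaf of `X` because that can be tested
after pullback to `Y`. -/
theorem map_twistSections [IsClosedImmersion f] (h : HasDepthTwo (saturatedIdeal f)) (n : ℤ) :
    (twistSections (𝟙 (ProjSpace k N)) (idealSheaf (j ≫ f)) n).map (pullbackCochains f) =
      twistSections f (idealSheaf j) n := by
  refine le_antisymm ?_ fun s hs => ?_
  · rintro _ ⟨s, hs, rfl⟩
    exact pullbackCochains_mem f j hs
  · obtain ⟨g, hg, hg0, hgs⟩ := exists_form_of_mem_twist f h n s ⟨fun _ => trivial, hs.2⟩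
    have hsg : formCochain f n.toNat g = s := _root_.funext fun i => (hgs i).symm
    rcases lt_or_ge n 0 with hn | hn
    · rw [← hsg, hg0 hn, map_zero]
      exact Submodule.zero_mem _
    · refine ⟨formCochain (𝟙 _) n.toNat g, ⟨fun i => ?_, (formCochain_mem (𝟙 _) hn g).2⟩, ?_⟩
      · change ((j ≫ f).app _).hom _ = 0
        have h1 := hs.1 i
        rw [← hsg, ← pullbackCochains_formCochain] at h1
        exact h1
      · rw [pullbackCochains_formCochain, hsg]

theorem inf_ker_pullbackCochains (n : ℤ) :
    twistSections (𝟙 (ProjSpace k N)) (idealSheaf (j ≫ f)) n ⊓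
      LinearMap.ker (pullbackCochains f) = twistSections (𝟙 (ProjSpace k N)) (idealSheaf f) n := by
  ext s
  constructor
  · rintro ⟨hs, hk⟩
    exact ⟨fun i => congrFun hk i, hs.2⟩
  · intro hs
    have hk : ∀ i, (f.app (⊤ ⊓ chart (𝟙 (ProjSpace k N)) i)).hom (s i) = 0 := hs.1
    refine ⟨⟨fun i => ?_, hs.2⟩, funext hk⟩
    change (j.app _).hom ((f.app _).hom (s i)) = 0
    rw [hk, map_zero]

/-- Rank–nullity for pullback to `Y`, whose kernel consists of the sections of `𝓘_Y(n)`. -/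
theorem finrank_twistSections_comp [IsClosedImmersion f] (h : HasDepthTwo (saturatedIdeal f))
    (n : ℤ)
    [Module.Finite k (twistSections (𝟙 (ProjSpace k N)) (idealSheaf (j ≫ f)) n)] :
    Module.finrank k (twistSections (𝟙 (ProjSpace k N)) (idealSheaf (j ≫ f)) n) =
      Module.finrank k (twistSections f (idealSheaf j) n) +
        Module.finrank k (twistSections (𝟙 (ProjSpace k N)) (idealSheaf f) n) := by
  set A := twistSections (𝟙 (ProjSpace k N)) (idealSheaf (j ≫ f)) n with hA
  have h1 := LinearMap.finrank_range_add_finrank_ker ((pullbackCochains f).domRestrict A)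
  rw [LinearMap.range_domRestrict, hA, map_twistSections f j h, ← hA] at h1
  rw [← h1, ← inf_ker_pullbackCochains f j n, ← hA, LinearMap.ker_domRestrict,
    ← Submodule.map_comap_subtype, Submodule.finrank_map_subtype_eq]

variable {f j j'}

variable {h : ℤ} (E : TwistedIdealIso f j j' h) (n : ℤ)

/-- Linearity carries the transition function of degree `n` through, and changing the chart of the
component contributes the one of degree `h`; their product has degree `n + h`. -/
theorem TwistedIdealIso.component_mem_twist {s : Cochains f}
    (hs : s ∈ twistSections f (idealSheaf j) n) :
    (fun i => E.component (⊤ ⊓ chart f i) i inf_le_right ⟨s i, hs.1 i⟩ : Cochains f) ∈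
      twistSections f (idealSheaf j') (n + h) := by
  refine ⟨fun i => E.component_mem _ _ _ _, fun i l W hi hl => ?_⟩
  have h1 : (⟨res hi (s i), res_mem_idealSheaf j hi (hs.1 i)⟩ : idealSheaf j W) =
      transition f n i l W (hi.trans inf_le_right) (hl.trans inf_le_right) •
        ⟨res hl (s l), res_mem_idealSheaf j hl (hs.1 l)⟩ :=
    Subtype.ext (hs.2 i l W hi hl)
  rw [E.res_component hi, E.res_component hl]
  dsimp only
  rw [h1, map_smul, E.component_eq W i l (hi.trans inf_le_right) (hl.trans inf_le_right),
    transition_add, smul_eq_mul, mul_assoc]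

/-- The map on global sections of `𝓘_{X/Y}(n) ≅ 𝓘_{X'/Y}(n + h)`. -/
def TwistedIdealIso.sectionsMap :
    twistSections f (idealSheaf j) n →ₗ[k] twistSections f (idealSheaf j') (n + h) where
  toFun s := ⟨_, E.component_mem_twist n s.2⟩
  map_add' s t := Subtype.ext (_root_.funext fun i =>
    map_add (E.component (⊤ ⊓ chart f i) i inf_le_right) ⟨s.1 i, s.2.1 i⟩ ⟨t.1 i, t.2.1 i⟩)
  map_smul' c s := Subtype.ext (_root_.funext fun i =>
    map_smul (E.component (⊤ ⊓ chart f i) i inf_le_right) (res le_top (pullbackScalars f c))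
      ⟨s.1 i, s.2.1 i⟩)

theorem TwistedIdealIso.sectionsMap_injective : Function.Injective (E.sectionsMap n) := by
  intro s t hst
  refine Subtype.ext (_root_.funext fun i => ?_)
  have h1 := congrFun (congrArg Subtype.val hst) i
  exact congrArg Subtype.val (E.component_injective (⊤ ⊓ chart f i) i inf_le_right h1)

theorem TwistedIdealIso.sectionsMap_surjective : Function.Surjective (E.sectionsMap n) := by
  intro t
  choose s hs using fun i =>
    E.exists_component_eq (⊤ ⊓ chart f i) i inf_le_right (t.1 i) (t.2.1 i)
  refine ⟨⟨fun i => (s i).1, fun i => (s i).2, fun i l W hi hl => ?_⟩,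
    Subtype.ext (_root_.funext fun i => hs i)⟩
  -- The chartwise preimages satisfy the gluing relation because their images do and components are
  -- injective.
  have h1 : (⟨res hi (s i).1, res_mem_idealSheaf j hi (s i).2⟩ : idealSheaf j W) =
      transition f n i l W (hi.trans inf_le_right) (hl.trans inf_le_right) •
        ⟨res hl (s l).1, res_mem_idealSheaf j hl (s l).2⟩ := by
    refine E.component_injective W i (hi.trans inf_le_right) ?_
    rw [map_smul, E.component_eq W i l (hi.trans inf_le_right) (hl.trans inf_le_right)
      ⟨res hl _, _⟩, ← E.res_component hi i inf_le_right (s i),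
      ← E.res_component hl l inf_le_right (s l), hs, hs,
      t.2.2 i l W hi hl, transition_add, smul_eq_mul, mul_assoc]
  exact congrArg Subtype.val h1

theorem TwistedIdealIso.finrank_eq (E : TwistedIdealIso f j j' h) (n : ℤ) :
    Module.finrank k (twistSections f (idealSheaf j) n) =
      Module.finrank k (twistSections f (idealSheaf j') (n + h)) :=
  (LinearEquiv.ofBijective (E.sectionsMap n)
    ⟨E.sectionsMap_injective n, E.sectionsMap_surjective n⟩).finrank_eq

end Cohomology

/-! ### Depth two from the Cohen–Macaulay condition -/

section Depth
open MvPolynomial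

theorem mk_mem_smul_top_iff {R : Type*} [CommRing R] (a x : R) :
    (Submodule.Quotient.mk x : QuotSMulTop a R) = 0 ↔ ∃ y, a * y = x := by
  rw [Submodule.Quotient.mk_eq_zero, Submodule.mem_smul_pointwise_iff_exists]
  simp

theorem mul_sub_mul_inverse_eq_zero {R : Type*} [CommRing R] (a y w : R) {v v' : R}
    (h : v * v' = 1) : w * (a * y) - a * v * (v' * y * w) = 0 := by
  linear_combination (-a * y * w) * h

/-- The chain `P₁ < P₀ <` irrelevant ideal forces dimension at least two in the local ring at the
origin, so its maximal regular sequence has two initial terms; clearing denominators moves them to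
polynomials. Gradedness of `I` makes regularity of `a` global. The ideal `I + (a)` need not be
graded, so for `b` the factor `w` remains. -/
theorem hasDepthTwo_of_isCMRing {I P₁ P₀ : Ideal (CoordRing k N)} [P₁.IsPrime] [P₀.IsPrime]
    (hI : IsGradedIdeal I) (hcm : IsCMRing (CoordRing k N ⧸ I)) (hIP : I ≤ P₁) (h10 : P₁ < P₀)
    (h0 : P₀ < RingHom.ker (constantCoeff : CoordRing k N →+* k)) : HasDepthTwo I := by
  have hI0 : ∀ p ∈ I, (constantCoeff : CoordRing k N →+* k) p = 0 := fun p hp =>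
    h0.le (h10.le (hIP hp))
  let m : Ideal (CoordRing k N ⧸ I) := RingHom.ker (Ideal.Quotient.lift I constantCoeff hI0)
  have hm : m.IsMaximal := RingHom.ker_isMaximal_of_surjective _
    (Ideal.Quotient.lift_surjective_of_surjective _ _ fun c => ⟨C c, constantCoeff_C _ c⟩)
  have hmem : ∀ p, Ideal.Quotient.mk I p ∈ m ↔ constantCoeff p = 0 := fun p => by
    rw [RingHom.mem_ker, Ideal.Quotient.lift_mk]
  obtain ⟨-, rs, hrs, hreg, hlen⟩ := hcm.2 m
  have hheight : (2 : ℕ∞) ≤ m.height := by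
    have hmk := Ideal.Quotient.mk_surjective (I := I)
    have hker : ∀ P : Ideal (CoordRing k N), I ≤ P →
        (P.map (Ideal.Quotient.mk I)).comap (Ideal.Quotient.mk I) = P := fun P hP => by
      rw [Ideal.comap_map_of_surjective _ hmk, ← RingHom.ker_eq_comap_bot, Ideal.mk_ker,
        sup_eq_left.mpr hP]
    have : (P₁.map (Ideal.Quotient.mk I)).IsPrime :=
      Ideal.map_isPrime_of_surjective hmk (by rwa [Ideal.mk_ker])
    have : (P₀.map (Ideal.Quotient.mk I)).IsPrime :=
      Ideal.map_isPrime_of_surjective hmk (by rw [Ideal.mk_ker]; exact hIP.trans h10.le)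
    have hlt1 : P₁.map (Ideal.Quotient.mk I) < P₀.map (Ideal.Quotient.mk I) := by
      refine lt_of_le_of_ne (Ideal.map_mono h10.le) fun h => h10.ne ?_
      rw [← hker P₁ hIP, h, hker P₀ (hIP.trans h10.le)]
    have hlt0 : P₀.map (Ideal.Quotient.mk I) < m := by
      refine lt_of_le_of_ne (Ideal.map_le_iff_le_comap.mpr fun p hp => (hmem p).mpr (h0.le hp))
        fun h => h0.ne ?_
      rw [← hker P₀ (hIP.trans h10.le), h]
      ext p
      exact hmem p
    have e1 := Ideal.height_add_one_le_of_lt_of_isPrime hlt1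
    have e2 := Ideal.height_add_one_le_of_lt_of_isPrime hlt0
    calc (2 : ℕ∞) = 0 + 1 + 1 := by norm_num
      _ ≤ _ := (add_le_add_left ((add_le_add_left zero_le 1).trans e1) 1).trans e2
  have hlen2 : 2 ≤ rs.length := by
    rw [IsLocalization.AtPrime.ringKrullDim_eq_height m] at hlen
    rw [← WithBot.coe_le_coe, ← hlen] at hheight
    exact_mod_cast hheight
  obtain ⟨a', b', rs, rfl⟩ : ∃ a' b' l, rs = a' :: b' :: l := by
    match rs, hlen2 with
    | a :: b :: l, _ => exact ⟨a, b, l, rfl⟩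
  obtain ⟨hra, hreg1⟩ :=
    (RingTheory.Sequence.isWeaklyRegular_cons_iff _ _ _).mp hreg.toIsWeaklyRegular
  have hrb := ((RingTheory.Sequence.isWeaklyRegular_cons_iff _ _ _).mp hreg1).1
  let L := Localization.AtPrime m
  let ψ : CoordRing k N →+* L := (algebraMap _ L).comp (Ideal.Quotient.mk I)
  have hψ0 : ∀ p, ψ p = 0 → ∃ w, constantCoeff w ≠ 0 ∧ w * p ∈ I := by
    intro p hp
    obtain ⟨⟨w, hw⟩, hwp⟩ := (IsLocalization.map_eq_zero_iff m.primeCompl L _).mp hp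
    obtain ⟨w, rfl⟩ := Ideal.Quotient.mk_surjective w
    refine ⟨w, fun h => hw ((hmem w).mpr h), ?_⟩
    have h1 : Ideal.Quotient.mk I (w * p) = 0 := (map_mul _ _ _).trans hwp
    rwa [Ideal.Quotient.eq_zero_iff_mem] at h1
  have hunit : ∀ w, constantCoeff w ≠ 0 → IsUnit (ψ w) := fun w hw =>
    IsLocalization.map_units L (⟨Ideal.Quotient.mk I w, fun h => hw ((hmem w).mp h)⟩ : m.primeCompl)
  have hfrac : ∀ z : L, ∃ p w, constantCoeff w ≠ 0 ∧ z * ψ w = ψ p := by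
    intro z
    obtain ⟨x, ⟨w, hw⟩, hx⟩ := IsLocalization.exists_mk'_eq m.primeCompl z
    obtain ⟨p, rfl⟩ := Ideal.Quotient.mk_surjective x
    obtain ⟨w, rfl⟩ := Ideal.Quotient.mk_surjective w
    exact ⟨p, w, fun h => hw ((hmem w).mpr h), by rw [← hx]; exact IsLocalization.mk'_spec L _ _⟩
  have hlift : ∀ z ∈ IsLocalRing.maximalIdeal L, ∃ p w, constantCoeff p = 0 ∧
      constantCoeff w ≠ 0 ∧ z * ψ w = ψ p := by
    intro z hz
    obtain ⟨p, w, hw, hzw⟩ := hfrac z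
    refine ⟨p, w, ?_, hw, hzw⟩
    by_contra hp
    have h1 := hunit p hp
    rw [← hzw] at h1
    exact (IsLocalRing.mem_maximalIdeal z).mp hz (isUnit_of_mul_isUnit_left h1)
  -- Multiplying by units of the local ring does not affect regularity, so numerators may replace
  -- `a'` and `b'`.
  obtain ⟨a, s, ha, hs, has⟩ := hlift a' (hrs a' (by simp))
  obtain ⟨b, t, hb, ht, hbt⟩ := hlift b' (hrs b' (by simp))
  have hψI : ∀ p ∈ I, ψ p = 0 := fun p hp => by
    change algebraMap _ L (Ideal.Quotient.mk I p) = 0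
    rw [Ideal.Quotient.eq_zero_iff_mem.mpr hp, map_zero]
  refine ⟨a, b, ha, hb, fun p hp => ?_, fun p hp => ?_⟩
  · have h1 := hψI _ hp
    rw [map_mul, ← has, mul_assoc] at h1
    have h2 : ψ s * ψ p = 0 := hra (by simpa using h1)
    obtain ⟨w, hw, hwp⟩ := hψ0 p ((hunit s hs).mul_right_eq_zero.mp h2)
    exact hI.mem_of_mul_mem hw hwp
  · obtain ⟨q, hq⟩ := mem_sup_span_singleton.mp hp
    have h1 := hψI _ hq
    rw [map_sub, map_mul, map_mul, ← has, ← hbt, sub_eq_zero] at h1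
    have h2 : (Submodule.Quotient.mk (ψ t * ψ p) : QuotSMulTop a' L) = 0 := by
      refine hrb ?_
      change b' • Submodule.Quotient.mk _ = b' • 0
      rw [smul_zero, ← Submodule.Quotient.mk_smul, mk_mem_smul_top_iff]
      exact ⟨ψ s * ψ q, by rw [smul_eq_mul, ← mul_assoc, ← mul_assoc, h1]⟩
    obtain ⟨y, hy⟩ := (mk_mem_smul_top_iff _ _).mp h2
    obtain ⟨v, hv⟩ := hunit s hs
    obtain ⟨g, w, hw, hg⟩ := hfrac (((v⁻¹ : Lˣ) : L) * y)
    have h3 : ψ (w * t * p - a * g) = 0 := by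
      rw [map_sub, map_mul, map_mul, map_mul, mul_assoc, ← hy, ← hg, ← has, ← hv]
      exact mul_sub_mul_inverse_eq_zero _ _ _ v.mul_inv
    obtain ⟨w', hw', h4⟩ := hψ0 _ h3
    refine ⟨w' * (w * t), by simp [hw, hw', ht], mem_sup_span_singleton.mpr ⟨w' * g, ?_⟩⟩
    convert h4 using 1
    ring

/-- Some `X l` lies outside the prime of `f y`. If `F` did too, `F / x_l^n` would be invertible at
`y`, although it is zero on `Y`. -/
theorem saturatedIdeal_le {Y : Scheme.{u}} (f : Y ⟶ ProjSpace k N) (y : Y) :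
    saturatedIdeal f ≤ (f y).asHomogeneousIdeal.toIdeal := by
  refine Ideal.span_le.mpr ?_
  rintro F ⟨n, hF, h⟩
  by_contra hFy
  obtain ⟨l, hl⟩ : ∃ l : Fin (N + 1), X l ∉ (f y).asHomogeneousIdeal.toIdeal := by
    by_contra! hall
    refine (f y).not_irrelevant_le fun p hp => ?_
    have h1 : p ∈ Ideal.span (Set.range (X : Fin (N + 1) → CoordRing k N)) := by
      rw [mem_span_X_iff]
      have h2 := (HomogeneousIdeal.mem_irrelevant_iff (grading k N) p).mp hp
      have h3 : homogeneousComponent 0 p = 0 := by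
        refine Eq.trans ?_ h2
        exact (decomposition.decompose'_apply p 0).symm
      rwa [homogeneousComponent_zero, C_eq_zero, ← constantCoeff_eq] at h3
    refine (Ideal.span_le.mpr ?_) h1
    rintro _ ⟨l, rfl⟩
    exact hall l
  have h1 : formFun f l n F = 0 := by
    rw [formFun_of_mem f l hF]
    exact h l
  have h2 := basicOpen_formFun f l ((mem_homogeneousSubmodule _ _).mp hF)
  rw [h1, Scheme.basicOpen_zero] at h2
  have h3 : y ∈ chart f l ⊓ f ⁻¹ᵁ Proj.basicOpen (grading k N) F := ⟨hl, hFy⟩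
  rw [← h2] at h3
  exact h3

theorem asHomogeneousIdeal_lt_ker (x : ProjSpace k N) :
    x.asHomogeneousIdeal.toIdeal < RingHom.ker (constantCoeff : CoordRing k N →+* k) := by
  have hgr : ∀ p ∈ x.asHomogeneousIdeal.toIdeal,
      homogeneousComponent 0 p ∈ x.asHomogeneousIdeal.toIdeal := fun p hp =>
    homogeneousComponent_mem_of_mem x.asHomogeneousIdeal.isHomogeneous hp 0
  refine lt_of_le_of_ne (fun p hp => ?_) fun h => x.not_irrelevant_le ?_
  · by_contra hne
    have h1 := hgr p hp
    rw [homogeneousComponent_zero, ← constantCoeff_eq] at h1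
    exact (inferInstance : x.asHomogeneousIdeal.toIdeal.IsPrime).ne_top
      (Ideal.eq_top_of_isUnit_mem _ h1 ((IsUnit.mk0 _ hne).map C))
  · intro p hp
    change p ∈ x.asHomogeneousIdeal.toIdeal
    rw [h, RingHom.mem_ker]
    have h2 := (HomogeneousIdeal.mem_irrelevant_iff (grading k N) p).mp hp
    have h3 : homogeneousComponent 0 p = 0 := by
      refine Eq.trans ?_ h2
      exact (decomposition.decompose'_apply p 0).symm
    rwa [homogeneousComponent_zero, C_eq_zero, ← constantCoeff_eq] at h3

theorem hasDepthTwo_saturatedIdeal {Y : Scheme.{u}} (f : Y ⟶ ProjSpace k N) [IsClosedImmersion f]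
    (hacm : IsACM f) {M : ℕ} (hdim : topologicalKrullDim Y = ((M + 1 : ℕ) : WithBot ℕ∞)) :
    HasDepthTwo (saturatedIdeal f) := by
  have h1 : 1 ≤ Order.krullDim (TopologicalSpace.IrreducibleCloseds Y) := by
    change 1 ≤ topologicalKrullDim Y
    rw [hdim]
    exact_mod_cast Nat.le_add_left 1 M
  -- Generic points of two nested irreducible closed sets give the required chain of primes; the
  -- larger set `C₁` has the smaller prime.
  obtain ⟨C₀, C₁, hC⟩ := Order.one_le_krullDim_iff.mp h1
  have g₀ := C₀.isIrreducible.isGenericPoint_genericPoint C₀.isClosed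
  have g₁ := C₁.isIrreducible.isGenericPoint_genericPoint C₁.isClosed
  set y₀ := C₀.isIrreducible.genericPoint
  set y₁ := C₁.isIrreducible.genericPoint
  have hspec : y₁ ⤳ y₀ := by
    rw [specializes_iff_mem_closure, g₁]
    exact hC.le g₀.mem
  have hne : f y₁ ≠ f y₀ := fun h => by
    have h2 : y₁ = y₀ := f.isClosedEmbedding.injective h
    refine hC.ne (TopologicalSpace.IrreducibleCloseds.ext ?_)
    rw [← g₀, ← g₁, h2]
  have hspec' : f y₁ ⤳ f y₀ := hspec.map f.continuous
  have hle : (f y₁).asHomogeneousIdeal ≤ (f y₀).asHomogeneousIdeal :=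
    (ProjectiveSpectrum.le_iff_mem_closure (𝒜 := grading k N) (f y₁) (f y₀)).mpr
      hspec'.mem_closure
  have hlt : (f y₁).asHomogeneousIdeal.toIdeal < (f y₀).asHomogeneousIdeal.toIdeal :=
    lt_of_le_of_ne hle fun h => hne (ProjectiveSpectrum.ext (HomogeneousIdeal.toIdeal_injective h))
  exact hasDepthTwo_of_isCMRing (isGradedIdeal_saturatedIdeal f) hacm (saturatedIdeal_le f y₁) hlt
    (asHomogeneousIdeal_lt_ker (f y₀))

theorem saturatedIdeal_id : saturatedIdeal (𝟙 (ProjSpace k N)) = ⊥ := by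
  refine le_bot_iff.mp fun p hp => ?_
  rw [mem_saturatedIdeal_iff] at hp
  rw [Ideal.mem_bot, ← sum_homogeneousComponent p]
  exact Finset.sum_eq_zero fun d _ =>
    eq_zero_of_formQuot_eq_zero 0 d _ (homogeneousComponent_mem d p) (hp d 0)

/-- Two distinct variables form a regular sequence on `S`. Applied to projective space itself, the
description of sections by forms gives the finite dimensionality that rank–nullity requires. -/
theorem hasDepthTwo_saturatedIdeal_id (hN : 1 ≤ N) :
    HasDepthTwo (saturatedIdeal (𝟙 (ProjSpace k N))) := by
  rw [saturatedIdeal_id]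
  have h01 : (0 : Fin (N + 1)) ≠ Fin.last N := by
    rw [Ne, Fin.ext_iff, Fin.val_zero, Fin.val_last]
    omega
  refine ⟨X 0, X (Fin.last N), constantCoeff_X _ _, constantCoeff_X _ _, fun p hp => ?_,
    fun p hp => ⟨1, by simp, ?_⟩⟩
  · rw [Ideal.mem_bot] at hp ⊢
    exact (mul_eq_zero.mp hp).resolve_left (X_ne_zero 0)
  · rw [bot_sup_eq, Ideal.mem_span_singleton] at hp ⊢
    rw [one_mul]
    exact ((MvPolynomial.X_prime (i := 0)).dvd_or_dvd hp).resolve_left fun h => h01 (X_dvd_X.mp h)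

end Depth

/-! ### Difference calculus and conclusion -/

theorem diff_add (φ ψ : ℤ → ℤ) : diff (φ + ψ) = diff φ + diff ψ := by
  funext n
  simp only [diff, Pi.add_apply]
  ring

theorem diff_shift (φ : ℤ → ℤ) : diff (fun n => φ (n - 1)) = fun n => diff φ (n - 1) := rfl

theorem iterate_diff_add (m : ℕ) (φ ψ : ℤ → ℤ) : diff^[m] (φ + ψ) = diff^[m] φ + diff^[m] ψ := by
  induction m generalizing φ ψ with
  | zero => rfl
  | succ m ih => rw [Function.iterate_succ_apply, diff_add, ih]; rfl

theorem iterate_diff_shift (m : ℕ) (φ : ℤ → ℤ) :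
    diff^[m] (fun n => φ (n - 1)) = fun n => diff^[m] φ (n - 1) := by
  induction m generalizing φ with
  | zero => rfl
  | succ m ih => rw [Function.iterate_succ_apply, diff_shift, ih]; rfl

/-- The difference already present on `ψ` supplies the extra iterate: `Y` has dimension one more
than `X`, so its character is a difference of order `M + 3`. -/
theorem iterate_diff_eq_of_eq_shift_add_diff {φ ψ χ : ℤ → ℤ}
    (h : ∀ n, χ n = φ (n - 1) + diff ψ n) (m : ℕ) (n : ℤ) :
    diff^[m] χ n = diff^[m] φ (n - 1) + diff^[m + 1] ψ n := by
  have h' : χ = (fun n => φ (n - 1)) + diff ψ := funext h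
  rw [h', iterate_diff_add, iterate_diff_shift]
  rfl

theorem hZero_comp (hN : 1 ≤ N) {X Y : Scheme.{u}} (i : Y ⟶ ProjSpace k N) (j : X ⟶ Y)
    [IsClosedImmersion i] (h : HasDepthTwo (saturatedIdeal i)) (n : ℤ) :
    hZero (idealSheaf (j ≫ i)) n =
      Module.finrank k (twistSections i (idealSheaf j) n) + hZero (idealSheaf i) n := by
  have := finite_twistSections (𝟙 (ProjSpace k N)) (hasDepthTwo_saturatedIdeal_id hN)
    (idealSheaf (j ≫ i)) n
  rw [hZero_eq_finrank, hZero_eq_finrank, finrank_twistSections_comp i j h]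

end Postulation
end

theorem proposition1p12 {k : Type u} [Field k] [IsAlgClosed k] {N : ℕ} (hN : 2 ≤ N) (M : ℕ)
    {X X' Y : Scheme.{u}} (i : Y ⟶ Postulation.ProjSpace k N) (j : X ⟶ Y) (j' : X' ⟶ Y)
    (hbil : Postulation.IsElementaryGorensteinBiliaison i j j' M 1) (n : ℤ) :
    Postulation.postulationCharacter M (j' ≫ i) n =
      Postulation.postulationCharacter M (j ≫ i) (n - 1) +
        Postulation.postulationCharacter (M + 1) i n := by
  obtain ⟨E⟩ := hbil.linEquiv
  have := hbil.closed_Y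
  have hd := Postulation.hasDepthTwo_saturatedIdeal i hbil.acm hbil.dim_Y
  refine Postulation.iterate_diff_eq_of_eq_shift_add_diff (fun n => ?_) (M + 2) n
  have h1 := Postulation.hZero_comp (by omega) i j' hd n
  have h2 := Postulation.hZero_comp (by omega) i j hd (n - 1)
  -- Height one carries degree `n - 1` on `X` to degree `n` on `X'`, so `h1` and `h2` share their
  -- relative term.
  rw [E.finrank_eq, sub_add_cancel] at h2
  simp only [Postulation.diff, h1, h2]
  push_cast
  ring
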